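/- Let $N\ge 2$, $0<\kappa\le\frac14$, $\alpha_+=1+\sqrt{1-4\kappa}$, let $({\bf e}_1,\dots,{\bf e}_N)$ be the canonical basis of $\mathbb R^N$, and let $S^{N-1}_+=\{\sigma\in\mathbb R^N:\ |\sigma|=1,\ {\bf e}_N\cdot\sigma>0\}$, with surface measure $dS$, tangential gradient $\nabla'$ and Laplace–Beltrami operator $\Delta'$. Put $\rho_\kappa(\sigma)=({\bf e}_N\cdot\sigma)^{\alpha_+/2}$. For a weight $\rho$, $H^1_0(S^{N-1}_+,\rho\,dS)$ denotes the closure of $C_c^\infty(S^{N-1}_+)$ for the norm $\big(\int_{S^{N-1}_+}(w^2+|\nabla'w|^2)\rho\,dS\big)^{1/2}$, and $H^1_0(S^{N-1}_+)=H^1_0(S^{N-1}_+,dS)$. An eigenfunction of the spherical Hardy operator $\mathcal L'_\kappa=-\Delta'-\kappa({\bf e}_N\cdot\sigma)^{-2}$ on $S^{N-1}_+$ for the eigenvalue $\mu\in\mathbb R$ is a function $\psi$, not a.e. zero, such that $\rho_\kappa^{-1}\psi\in H^1_0(S^{N-1}_+,\rho_\kappa^2\,dS)$ and $\mathcal L'_\kappa\psi=\mu\psi$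 in the sense of distributions in $S^{N-1}_+$. (i) For every $\psi\in H^1_0(S^{N-1}_+)$ the function $({\bf e}_N\cdot\sigma)^{-2}\psi^2$ is integrable on $S^{N-1}_+$, and $$\mu_{\kappa,1}:=\inf_{\psi\in H^1_0(S^{N-1}_+)\setminus\{0\}}\frac{\int_{S^{N-1}_+}\big(|\nabla'\psi|^2-\kappa({\bf e}_N\cdot\sigma)^{-2}\psi^2\big)dS}{\int_{S^{N-1}_+}\psi^2\,dS}=\frac{\alpha_+}{2}\Big(N+\frac{\alpha_+}{2}-2\Big).$$ This number is the smallest eigenvalue of $\mathcal L'_\kappa$, the positive function $\rho_\kappa$ is an eigenfunction for it, and every eigenfunction for it is a.e. a multiple of $\rho_\kappa$. (ii) The smallest eigenvalue of $\mathcal L'_\kappa$ larger than $\mu_{\kappa,1}$ is $\mu_{\kappa,2}=\mu_{\kappa,1}+N+\alpha_+-1$. The $N-1$ functions $\rho_{\kappa,j}(\sigma)=({\bf e}_N\cdot\sigma)^{\alpha_+/2}\,{\bf e}_j\cdot\sigma$, $j=1,\dots,N-1$, are linearly independent eigenfunctions for $\mu_{\kappa,2}$, and every eigenfunction for $\mu_{\kappa,2}$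 is a.e. a linear combination of them. -/

import Mathlib

open MeasureTheory Filter Topology
open scoped ContDiff Laplacian

noncomputable section

namespace HardySphere

/-- The ambient Euclidean space `ℝ^N`, with `N = n + 1`. -/
abbrev Amb (n : ℕ) : Type := EuclideanSpace ℝ (Fin (n + 1))

/-- The unit sphere `S^{N-1}` of `ℝ^N`, with `N = n + 1`. -/
abbrev Sph (n : ℕ) : Type := Metric.sphere (0 : Amb n) 1

/-- The height `e_N · σ` of a point of the sphere (last coordinate). -/
def height {n : ℕ} (σ : Sph n) : ℝ := (σ : Amb n) (Fin.last n)

/-- The open half-sphere `S^{N-1}_+ = {σ ∈ S^{N-1} : e_N · σ > 0}`. -/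
def upper (n : ℕ) : Set (Sph n) := {σ | 0 < height σ}

/-- The surface measure `dS` on the half-sphere. -/
def dS (n : ℕ) : Measure (Sph n) := (volume : Measure (Amb n)).toSphere.restrict (upper n)

/-- The extension `x ↦ f (x / |x|)` of a function on the sphere, constant along rays
(with the irrelevant value `0` at the origin). -/
def radialExt {n : ℕ} (f : Sph n → ℝ) (x : Amb n) : ℝ :=
  if hx : x = 0 then 0
  else f ⟨‖x‖⁻¹ • x, by
    rw [mem_sphere_zero_iff_norm, norm_smul, norm_inv, norm_norm,
      inv_mul_cancel₀ (norm_ne_zero_iff.mpr hx)]⟩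

/-- The tangential gradient `∇'f`: the Euclidean gradient, at a point of the sphere, of the
extension that is constant along rays (which has no radial component). -/
def sphGrad {n : ℕ} (f : Sph n → ℝ) (σ : Sph n) : Amb n := gradient (radialExt f) (σ : Amb n)

/-- The Laplace-Beltrami operator `Δ'f` of the sphere: the Euclidean Laplacian, at a point of
the sphere, of the extension that is constant along rays. -/
def sphLap {n : ℕ} (f : Sph n → ℝ) (σ : Sph n) : ℝ := (Δ (radialExt f)) (σ : Amb n)

/-- `ζ ∈ C_c^∞(S^{N-1}_+)`: a smooth function on the sphere (i.e. `x ↦ ζ (x / |x|)` is smooth off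
the origin) with support in the open half-sphere (compact, as the sphere is compact). -/
def IsTest {n : ℕ} (ζ : Sph n → ℝ) : Prop :=
  ContDiffOn ℝ ∞ (radialExt ζ) {0}ᶜ ∧ tsupport ζ ⊆ upper n

/-- `w ∈ H^1_0(S^{N-1}_+, ν)` with gradient `G`, where `H^1_0(S^{N-1}_+, ν)` is the closure of
`C_c^∞(S^{N-1}_+)` for the norm `(∫ (w² + |∇'w|²) dν)^{1/2}`. -/
def HasH10Grad {n : ℕ} (ν : Measure (Sph n)) (w : Sph n → ℝ) (G : Sph n → Amb n) : Prop :=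
  MemLp w 2 ν ∧ MemLp G 2 ν ∧
    ∃ φ : ℕ → Sph n → ℝ, (∀ k, IsTest (φ k)) ∧
      Tendsto (fun k => eLpNorm (fun σ => φ k σ - w σ) 2 ν) atTop (𝓝 0) ∧
      Tendsto (fun k => eLpNorm (fun σ => sphGrad (φ k) σ - G σ) 2 ν) atTop (𝓝 0)

/-- `w ∈ H^1_0(S^{N-1}_+, ν)`. -/
def MemH10 {n : ℕ} (ν : Measure (Sph n)) (w : Sph n → ℝ) : Prop :=
  ∃ G : Sph n → Amb n, HasH10Grad ν w G

/-- The Hardy exponent `α₊ = 1 + √(1 - 4κ)`. -/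
def alphaPlus (κ : ℝ) : ℝ := 1 + Real.sqrt (1 - 4 * κ)

/-- `ρ_κ(σ) = (e_N · σ)^{α₊/2}`. -/
def rho {n : ℕ} (κ : ℝ) (σ : Sph n) : ℝ := height σ ^ (alphaPlus κ / 2)

/-- `ρ_{κ,j}(σ) = (e_N · σ)^{α₊/2} (e_j · σ)`, `j = 1, …, N - 1`. -/
def rhoJ {n : ℕ} (κ : ℝ) (j : Fin n) (σ : Sph n) : ℝ :=
  rho κ σ * (σ : Amb n) (Fin.castSucc j)

/-- The weighted measure `ρ_κ² dS` on the half-sphere. -/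
def weighted (n : ℕ) (κ : ℝ) : Measure (Sph n) :=
  (dS n).withDensity fun σ => ENNReal.ofReal (rho κ σ ^ 2)

/-- The Rayleigh quotients
`∫ (|∇'ψ|² - κ (e_N · σ)⁻² ψ²) dS / ∫ ψ² dS` of the nonzero `ψ ∈ H^1_0(S^{N-1}_+)`. -/
def rayleighQuotients (n : ℕ) (κ : ℝ) : Set ℝ :=
  {r | ∃ (ψ : Sph n → ℝ) (G : Sph n → Amb n), HasH10Grad (dS n) ψ G ∧ ¬ ψ =ᵐ[dS n] 0 ∧
    r = (∫ σ, (‖G σ‖ ^ 2 - κ * (height σ ^ 2)⁻¹ * ψ σ ^ 2) ∂(dS n)) / ∫ σ, ψ σ ^ 2 ∂(dS n)}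

/-- `ψ` is an eigenfunction for the eigenvalue `ev` of the spherical Hardy operator
`-Δ' - κ (e_N · σ)⁻²` on `S^{N-1}_+`: a nonzero function with
`ρ_κ⁻¹ ψ ∈ H^1_0(S^{N-1}_+, ρ_κ² dS)` such that `-Δ'ψ - κ (e_N · σ)⁻² ψ = ev ψ` in the sense of
distributions in `S^{N-1}_+`. -/
def IsEigenfunction {n : ℕ} (κ ev : ℝ) (ψ : Sph n → ℝ) : Prop :=
  MemH10 (weighted n κ) (fun σ => ψ σ / rho κ σ) ∧ ¬ ψ =ᵐ[dS n] 0 ∧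
    ∀ ζ : Sph n → ℝ, IsTest ζ →
      ∫ σ, ψ σ * (-sphLap ζ σ - κ * (height σ ^ 2)⁻¹ * ζ σ) ∂(dS n)
        = ev * ∫ σ, ψ σ * ζ σ ∂(dS n)

/-- The set of eigenvalues of the spherical Hardy operator on `S^{N-1}_+`, `N = n + 1`. -/
def eigenvalues (n : ℕ) (κ : ℝ) : Set ℝ :=
  {ev | ∃ ψ : Sph n → ℝ, IsEigenfunction κ ev ψ}

/-- The number `(α₊/2) (N + α₊/2 - 2)`. -/
def mu1 (N : ℕ) (κ : ℝ) : ℝ := alphaPlus κ / 2 * ((N : ℝ) + alphaPlus κ / 2 - 2)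

/-- The number `(α₊/2) (N + α₊/2 - 2) + N + α₊ - 1`. -/
def mu2 (N : ℕ) (κ : ℝ) : ℝ := mu1 N κ + (N : ℝ) + alphaPlus κ - 1

end HardySphere

end

/-! Write `h` for the height, `a = α₊/2` and `ρ = h^a`. Since `a` is a root of `t² - t + κ = 0`, the
substitution `ψ = ρ w` cancels the singular potential: the Hardy form of `ρ w` becomes `∫ (|∇'w|² +
μ₁ w²) ρ² dS` (`integral_ground_state`). Hence `μ₁` bounds the Rayleigh quotients from below, and
the spectral problem becomes `-ρ⁻² div'(ρ² ∇'w) = (ev - μ₁) w` in its weak form `IsWeak`.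

The infimum is sharp, and constants and linear forms solve the weighted problem, because smooth
functions lie in the weighted `H^1_0`: since `ρ² ≤ h`, the equator has zero capacity. For `κ = 1/4`
this holds only logarithmically, so the cut-offs average many dyadic steps
(`tendsto_integral_sphGrad_cutoff`).

The spectrum below and at `μ₂` is found without compactness or regularity theory. For `y ⟂ e_N` the
weighted operator sends `⟪y, σ⟫^(m+1)` to a combination of the powers `m+1` and `m-1`, so a weak
solution with parameter `ev` satisfies a recursion between its moments: `((m+1)(n+α₊+m) - ev)
M_{m+1} = m(m+1)‖y‖² M_{m-1}`. For `ev ≤ n + α₊` the factor on the left is positive when `m ≥ 1`, so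
all moments vanish once those of degree 0 and 1 do. The moments determine `w`: they give the Fourier
transform of its image under the projection to `x_N = 0`, which is injective on the half-sphere
(`ae_eq_zero_of_moments`). Degree 0 can survive only for `ev = 0` and degree 1 only for `ev = n +
α₊`. Subtracting a constant, respectively a linear form, identifies the two eigenspaces.

All integrations by parts come from one divergence theorem, `integral_inner_sphGrad_surf`, obtained
from flat space in polar coordinates. -/

open scoped RealInnerProductSpace

noncomputable section

namespace HardySphere

variable {n : ℕ}

/-! ### Calculus on the sphere -/

/-- The radial projection of a nonzero vector to the unit sphere. -/
def dir (x : Amb n) (hx : x ≠ 0) : Sph n :=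
  ⟨‖x‖⁻¹ • x, by
    rw [mem_sphere_zero_iff_norm, norm_smul, norm_inv, norm_norm,
      inv_mul_cancel₀ (norm_ne_zero_iff.mpr hx)]⟩

theorem radialExt_of_ne (f : Sph n → ℝ) {x : Amb n} (hx : x ≠ 0) :
    radialExt f x = f (dir x hx) := by
  simp [radialExt, hx, dir]

theorem norm_sph (σ : Sph n) : ‖(σ : Amb n)‖ = 1 := mem_sphere_zero_iff_norm.mp σ.2

theorem sph_ne_zero (σ : Sph n) : (σ : Amb n) ≠ 0 := by
  rw [← norm_ne_zero_iff, norm_sph]; exact one_ne_zero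

theorem dir_coe (σ : Sph n) : dir (σ : Amb n) (sph_ne_zero σ) = σ := by
  apply Subtype.ext; simp [dir]

@[simp] theorem radialExt_coe (f : Sph n → ℝ) (σ : Sph n) : radialExt f (σ : Amb n) = f σ := by
  rw [radialExt_of_ne f (sph_ne_zero σ), dir_coe]

theorem dir_smul {c : ℝ} (hc : 0 < c) {x : Amb n} (hx : x ≠ 0) :
    dir (c • x) (smul_ne_zero hc.ne' hx) = dir x hx := by
  apply Subtype.ext
  simp only [dir, norm_smul, Real.norm_eq_abs, abs_of_pos hc, smul_smul]
  congr 1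
  field_simp

theorem radialExt_smul (f : Sph n → ℝ) {c : ℝ} (hc : 0 < c) (x : Amb n) :
    radialExt f (c • x) = radialExt f x := by
  rcases eq_or_ne x 0 with rfl | hx
  · simp
  · rw [radialExt_of_ne f hx, radialExt_of_ne f (smul_ne_zero hc.ne' hx), dir_smul hc]

theorem radialExt_mul (f g : Sph n → ℝ) :
    radialExt (fun σ => f σ * g σ) = fun x => radialExt f x * radialExt g x := by
  ext x; by_cases hx : x = 0 <;> simp [radialExt, hx]

theorem radialExt_add (f g : Sph n → ℝ) :
    radialExt (fun σ => f σ + g σ) = fun x => radialExt f x + radialExt g x := by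
  ext x; by_cases hx : x = 0 <;> simp [radialExt, hx]

theorem eventually_ne_zero (σ : Sph n) : ∀ᶠ x : Amb n in 𝓝 (σ : Amb n), x ≠ 0 :=
  isOpen_ne.mem_nhds (sph_ne_zero σ)

theorem radialExt_comp_eventuallyEq (F : ℝ → ℝ) (f : Sph n → ℝ) (σ : Sph n) :
    radialExt (fun τ => F (f τ)) =ᶠ[𝓝 (σ : Amb n)] fun x => F (radialExt f x) := by
  filter_upwards [eventually_ne_zero σ] with x hx
  rw [radialExt_of_ne _ hx, radialExt_of_ne _ hx]

theorem radialExt_const_eventuallyEq (c : ℝ) (σ : Sph n) :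
    radialExt (fun _ : Sph n => c) =ᶠ[𝓝 (σ : Amb n)] fun _ => c :=
  radialExt_comp_eventuallyEq (fun _ => c) (fun _ => c) σ

theorem radialExt_congr {f g : Sph n → ℝ} {σ : Sph n} (h : f =ᶠ[𝓝 σ] g) :
    radialExt f =ᶠ[𝓝 (σ : Amb n)] radialExt g := by
  have hc : ContinuousAt (fun x : Amb n => ‖x‖⁻¹ • x) (σ : Amb n) := by
    have : ‖(σ : Amb n)‖ ≠ 0 := by simp
    fun_prop (disch := assumption)
  obtain ⟨U, hU, hσ⟩ := mem_nhds_induced _ _ _ |>.mp h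
  have hc' : U ∈ 𝓝 (‖(σ : Amb n)‖⁻¹ • (σ : Amb n)) := by simpa using hU
  filter_upwards [eventually_ne_zero σ, hc.preimage_mem_nhds hc'] with x hx hxU
  rw [radialExt_of_ne _ hx, radialExt_of_ne _ hx]
  exact hσ (show ((dir x hx : Sph n) : Amb n) ∈ U from hxU)

/-- Smoothness of a function on the sphere near a point. -/
def SmoothAt (f : Sph n → ℝ) (σ : Sph n) : Prop := ContDiffAt ℝ ∞ (radialExt f) (σ : Amb n)

/-- Smoothness of a function on the whole sphere. -/
def Smooth (f : Sph n → ℝ) : Prop := ∀ σ, SmoothAt f σ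

/-- `G` is the tangential gradient of `f` at `σ`. -/
def HasSphGrad (f : Sph n → ℝ) (G : Amb n) (σ : Sph n) : Prop :=
  HasGradientAt (radialExt f) G (σ : Amb n)

theorem radialExt_comp_smul (f : Sph n → ℝ) {c : ℝ} (hc : 0 < c) :
    (fun x => radialExt f (c • x)) = radialExt f := funext fun x => radialExt_smul f hc x

theorem coe_dir (x : Amb n) (hx : x ≠ 0) : ((dir x hx : Sph n) : Amb n) = ‖x‖⁻¹ • x := rfl

/-- The extension is invariant under positive dilations, which carry smoothness from the sphere to
the whole punctured space. -/
theorem Smooth.contDiffAt {f : Sph n → ℝ} (hf : Smooth f) {x : Amb n} (hx : x ≠ 0) :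
    ContDiffAt ℝ ∞ (radialExt f) x := by
  have hc : 0 < ‖x‖⁻¹ := inv_pos.mpr (norm_pos_iff.mpr hx)
  rw [← radialExt_comp_smul f hc]
  have h : ContDiffAt ℝ ∞ (radialExt f) (‖x‖⁻¹ • x) := hf (dir x hx)
  exact h.comp x (contDiff_const_smul (‖x‖⁻¹)).contDiffAt

theorem smooth_iff {f : Sph n → ℝ} : Smooth f ↔ ContDiffOn ℝ ∞ (radialExt f) {0}ᶜ :=
  ⟨fun h _ hx => (h.contDiffAt hx).contDiffWithinAt,
    fun h σ => h.contDiffAt (isOpen_compl_singleton.mem_nhds (sph_ne_zero σ))⟩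

theorem IsTest.smooth {f : Sph n → ℝ} (hf : IsTest f) : Smooth f := smooth_iff.mpr hf.1

theorem SmoothAt.congr {f g : Sph n → ℝ} {σ : Sph n} (hf : SmoothAt f σ) (h : g =ᶠ[𝓝 σ] f) :
    SmoothAt g σ := ContDiffAt.congr_of_eventuallyEq hf (radialExt_congr h)

theorem SmoothAt.mul {f g : Sph n → ℝ} {σ : Sph n} (hf : SmoothAt f σ) (hg : SmoothAt g σ) :
    SmoothAt (fun τ => f τ * g τ) σ := by
  rw [SmoothAt, radialExt_mul]; exact ContDiffAt.mul hf hg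

theorem SmoothAt.add {f g : Sph n → ℝ} {σ : Sph n} (hf : SmoothAt f σ) (hg : SmoothAt g σ) :
    SmoothAt (fun τ => f τ + g τ) σ := by
  rw [SmoothAt, radialExt_add]; exact ContDiffAt.add hf hg

theorem SmoothAt.comp {F : ℝ → ℝ} {f : Sph n → ℝ} {σ : Sph n} (hF : ContDiffAt ℝ ∞ F (f σ))
    (hf : SmoothAt f σ) : SmoothAt (fun τ => F (f τ)) σ := by
  refine ContDiffAt.congr_of_eventuallyEq ?_ (radialExt_comp_eventuallyEq F f σ)
  refine ContDiffAt.comp (σ : Amb n) ?_ hf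
  simpa using hF

theorem smoothAt_const (c : ℝ) (σ : Sph n) : SmoothAt (fun _ => c) σ :=
  contDiffAt_const.congr_of_eventuallyEq (radialExt_const_eventuallyEq c σ)

/-- The restriction of a linear form to the sphere. -/
def lin (y : Amb n) (σ : Sph n) : ℝ := ⟪y, (σ : Amb n)⟫

theorem radialExt_lin (y x : Amb n) : radialExt (lin y) x = ‖x‖⁻¹ * ⟪y, x⟫ := by
  by_cases hx : x = 0
  · simp [radialExt, hx]
  · rw [radialExt_of_ne _ hx, lin, coe_dir, inner_smul_right]

theorem smooth_lin (y : Amb n) : Smooth (lin y) := by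
  intro σ
  rw [SmoothAt, funext (radialExt_lin y)]
  have h1 : ContDiffAt ℝ ∞ (fun x : Amb n => ‖x‖) (σ : Amb n) := contDiffAt_norm ℝ (sph_ne_zero σ)
  exact (h1.inv (by simp)).mul (contDiffAt_const.inner ℝ contDiffAt_id)

theorem SmoothAt.differentiableAt {f : Sph n → ℝ} {σ : Sph n} (hf : SmoothAt f σ) :
    DifferentiableAt ℝ (radialExt f) (σ : Amb n) := ContDiffAt.differentiableAt hf (by simp)

theorem SmoothAt.hasSphGrad {f : Sph n → ℝ} {σ : Sph n} (hf : SmoothAt f σ) :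
    HasSphGrad f (sphGrad f σ) σ := hf.differentiableAt.hasGradientAt

theorem HasSphGrad.eq {f : Sph n → ℝ} {G : Amb n} {σ : Sph n} (h : HasSphGrad f G σ) :
    sphGrad f σ = G := HasGradientAt.gradient h

theorem HasSphGrad.congr {f g : Sph n → ℝ} {G : Amb n} {σ : Sph n} (hf : HasSphGrad f G σ)
    (h : g =ᶠ[𝓝 σ] f) : HasSphGrad g G σ :=
  HasGradientAt.congr_of_eventuallyEq hf (radialExt_congr h)

theorem HasSphGrad.mul {f g : Sph n → ℝ} {F G : Amb n} {σ : Sph n} (hf : HasSphGrad f F σ)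
    (hg : HasSphGrad g G σ) : HasSphGrad (fun τ => f τ * g τ) (f σ • G + g σ • F) σ := by
  rw [HasSphGrad, radialExt_mul, hasGradientAt_iff_hasFDerivAt]
  have := HasFDerivAt.fun_mul (hasGradientAt_iff_hasFDerivAt.mp hf) (hasGradientAt_iff_hasFDerivAt.mp hg)
  exact this.congr_fderiv (by simp)

theorem HasSphGrad.comp {F : ℝ → ℝ} {F' : ℝ} {f : Sph n → ℝ} {G : Amb n} {σ : Sph n}
    (hF : HasDerivAt F F' (f σ)) (hf : HasSphGrad f G σ) :
    HasSphGrad (fun τ => F (f τ)) (F' • G) σ := by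
  refine HasGradientAt.congr_of_eventuallyEq ?_ (radialExt_comp_eventuallyEq F f σ)
  rw [hasGradientAt_iff_hasFDerivAt]
  have hF' : HasDerivAt F F' (radialExt f (σ : Amb n)) := by simpa using hF
  have := hF'.comp_hasFDerivAt _ (hasGradientAt_iff_hasFDerivAt.mp hf)
  exact this.congr_fderiv (by simp)

theorem hasSphGrad_const (c : ℝ) (σ : Sph n) : HasSphGrad (fun _ => c) 0 σ :=
  (hasGradientAt_const (σ : Amb n) c).congr_of_eventuallyEq (radialExt_const_eventuallyEq c σ)

theorem hasSphGrad_lin (y : Amb n) (σ : Sph n) :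
    HasSphGrad (lin y) (y - lin y σ • (σ : Amb n)) σ := by
  rw [HasSphGrad, funext (radialExt_lin y), hasGradientAt_iff_hasFDerivAt]
  have h0 : HasFDerivAt (fun x : Amb n => ‖x‖ ^ 2) (2 • innerSL ℝ (σ : Amb n)) (σ : Amb n) :=
    (hasStrictFDerivAt_norm_sq (σ : Amb n)).hasFDerivAt
  have h1 : HasFDerivAt (fun x : Amb n => ⟪y, x⟫) (innerSL ℝ y) (σ : Amb n) :=
    (innerSL ℝ y).hasFDerivAt
  -- `‖x‖⁻¹` is differentiated as `(√(‖x‖²))⁻¹`.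
  have h2 : HasDerivAt (fun t : ℝ => (Real.sqrt t)⁻¹) (-(1 / (2 * Real.sqrt 1)) / (Real.sqrt 1) ^ 2)
      (‖(σ : Amb n)‖ ^ 2) := by
    rw [norm_sph]
    simpa using (Real.hasDerivAt_sqrt (one_ne_zero)).fun_inv (by simp)
  have h3 := (h2.comp_hasFDerivAt (σ : Amb n) h0).fun_mul h1
  simp only [Real.sqrt_sq (norm_nonneg _), Function.comp_def] at h3
  refine h3.congr_fderiv ?_
  ext v
  simp [lin]
  ring

/-- The extension is constant along the ray through `σ`. Without differentiability the gradient has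
the default value `0`, so no hypothesis on `f` is needed. -/
theorem inner_sphGrad_self (f : Sph n → ℝ) (σ : Sph n) : ⟪sphGrad f σ, (σ : Amb n)⟫ = 0 := by
  rw [sphGrad, inner_gradient_left]
  by_cases hd : DifferentiableAt ℝ (radialExt f) (σ : Amb n)
  swap
  · simp [fderiv_zero_of_not_differentiableAt hd]
  have h1 : HasDerivAt (fun t : ℝ => t • (σ : Amb n)) (σ : Amb n) 1 := by
    simpa using (hasDerivAt_id (1 : ℝ)).smul_const (σ : Amb n)
  have h2 : HasFDerivAt (radialExt f) (fderiv ℝ (radialExt f) (σ : Amb n)) ((1 : ℝ) • (σ : Amb n)) := by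
    simpa using hd.hasFDerivAt
  have h3 := h2.comp_hasDerivAt (1 : ℝ) h1
  have h4 : HasDerivAt (radialExt f ∘ fun t : ℝ => t • (σ : Amb n)) 0 1 := by
    refine (hasDerivAt_const (1 : ℝ) (f σ)).congr_of_eventuallyEq ?_
    filter_upwards [lt_mem_nhds (zero_lt_one' ℝ)] with t ht
    simp [radialExt_smul f ht]
  exact h3.unique h4

theorem hasSphGrad_zero_of_notMem_tsupport {f : Sph n → ℝ} {σ : Sph n} (h : σ ∉ tsupport f) :
    HasSphGrad f 0 σ := by
  refine (hasSphGrad_const 0 σ).congr ?_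
  exact notMem_tsupport_iff_eventuallyEq.mp h

theorem height_eq_lin (σ : Sph n) : height σ = lin (EuclideanSpace.single (Fin.last n) 1) σ := by
  simp [height, lin, EuclideanSpace.inner_single_left]

theorem smooth_height : Smooth (height (n := n)) := by
  rw [funext height_eq_lin]; exact smooth_lin _

theorem SmoothAt.continuousAt {f : Sph n → ℝ} {σ : Sph n} (hf : SmoothAt f σ) :
    ContinuousAt f σ := by
  have := hf.differentiableAt.continuousAt.comp
    (continuous_subtype_val (p := (· ∈ Metric.sphere (0 : Amb n) 1))).continuousAt (x := σ)
  simpa [Function.comp_def] using this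

theorem Smooth.continuous {f : Sph n → ℝ} (hf : Smooth f) : Continuous f :=
  continuous_iff_continuousAt.mpr fun σ => (hf σ).continuousAt

theorem continuous_height : Continuous (height (n := n)) := smooth_height.continuous

theorem isOpen_upper : IsOpen (upper n) := isOpen_lt continuous_const continuous_height

theorem Smooth.continuous_sphGrad {f : Sph n → ℝ} (hf : Smooth f) : Continuous (sphGrad f) := by
  refine continuous_iff_continuousAt.mpr fun σ => ?_
  have h1 : ContinuousAt (fderiv ℝ (radialExt f)) (σ : Amb n) :=
    (ContDiffAt.fderiv_right (m := 0) (hf σ) (by simp)).continuousAt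
  have h2 : ContinuousAt (gradient (radialExt f)) (σ : Amb n) :=
    (InnerProductSpace.toDual ℝ (Amb n)).symm.continuous.continuousAt.comp h1
  exact h2.comp (continuous_subtype_val (p := (· ∈ Metric.sphere (0 : Amb n) 1))).continuousAt

/-- A test function times a function that is smooth on the half-sphere is a test function. -/
theorem IsTest.mul_left {f η : Sph n → ℝ} (hη : IsTest η) (hf : ∀ σ ∈ upper n, SmoothAt f σ) :
    IsTest (fun σ => f σ * η σ) := by
  refine ⟨smooth_iff.mp fun σ => ?_, (tsupport_mul_subset_right (f := f)).trans hη.2⟩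
  by_cases hσ : σ ∈ tsupport η
  · exact (hf σ (hη.2 hσ)).mul (hη.smooth σ)
  · refine (smoothAt_const 0 σ).congr ?_
    filter_upwards [notMem_tsupport_iff_eventuallyEq.mp hσ] with τ hτ
    simp [hτ]

theorem IsTest.add {f g : Sph n → ℝ} (hf : IsTest f) (hg : IsTest g) :
    IsTest (fun σ => f σ + g σ) :=
  ⟨smooth_iff.mp fun σ => (hf.smooth σ).add (hg.smooth σ),
    (tsupport_add (f := f) (g := g)).trans (Set.union_subset hf.2 hg.2)⟩

theorem IsTest.zero_of_notMem {f : Sph n → ℝ} (hf : IsTest f) {σ : Sph n} (hσ : σ ∉ upper n) :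
    f σ = 0 := image_eq_zero_of_notMem_tsupport fun h => hσ (hf.2 h)

theorem IsTest.sphGrad_zero {f : Sph n → ℝ} (hf : IsTest f) {σ : Sph n} (hσ : σ ∉ upper n) :
    sphGrad f σ = 0 := (hasSphGrad_zero_of_notMem_tsupport fun h => hσ (hf.2 h)).eq

theorem smoothAt_height_rpow (p : ℝ) {σ : Sph n} (hσ : σ ∈ upper n) :
    SmoothAt (fun τ => height τ ^ p) σ :=
  SmoothAt.comp (F := fun t => t ^ p) (Real.contDiffAt_rpow_const_of_ne (ne_of_gt hσ))
    (smooth_height σ)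

theorem hasSphGrad_height (σ : Sph n) :
    HasSphGrad height (EuclideanSpace.single (Fin.last n) 1 - height σ • (σ : Amb n)) σ := by
  have := hasSphGrad_lin (EuclideanSpace.single (Fin.last n) 1) σ
  rwa [← height_eq_lin, ← funext height_eq_lin] at this

theorem hasSphGrad_height_rpow (p : ℝ) {σ : Sph n} (hσ : σ ∈ upper n) :
    HasSphGrad (fun τ => height τ ^ p) ((p * height σ ^ (p - 1)) •
      (EuclideanSpace.single (Fin.last n) 1 - height σ • (σ : Amb n))) σ :=
  HasSphGrad.comp (F := fun t => t ^ p) (Real.hasDerivAt_rpow_const (Or.inl (ne_of_gt hσ)))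
    (hasSphGrad_height σ)

/-! ### The divergence theorem on the sphere -/

/-- The surface measure of the whole sphere. -/
abbrev surf (n : ℕ) : Measure (Sph n) := (volume : Measure (Amb n)).toSphere

theorem homeomorphUnitSphereProd_fst (x : ({0}ᶜ : Set (Amb n))) :
    (homeomorphUnitSphereProd (Amb n) x).1 = dir x.1 x.2 :=
  Subtype.ext (by rw [homeomorphUnitSphereProd_apply_fst_coe]; rfl)

/-- Polar coordinates in dimension `n + 1`, with radial density `r ^ n`. Integrability is not
required, since the product formula for integrals holds with the default values as well. -/
theorem integral_polar (A : ℝ → ℝ) (g : Sph n → ℝ) :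
    ∫ x : Amb n, A ‖x‖ * radialExt g x
      = (∫ σ, g σ ∂(surf n)) * ∫ r in Set.Ioi (0 : ℝ), r ^ n * A r := by
  have hd : Module.finrank ℝ (Amb n) - 1 = n := by simp
  calc ∫ x : Amb n, A ‖x‖ * radialExt g x
      = ∫ x : ({(0 : Amb n)}ᶜ : Set (Amb n)), A ‖x.1‖ * radialExt g x.1 ∂(volume.comap Subtype.val) := by
        rw [integral_subtype_comap (measurableSet_singleton _).compl
          fun x : Amb n => A ‖x‖ * radialExt g x, restrict_compl_singleton]
    _ = ∫ p, g p.1 * A p.2.1 ∂((surf n).prod (Measure.volumeIoiPow n)) := by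
        have := (volume : Measure (Amb n)).measurePreserving_homeomorphUnitSphereProd.integral_comp
          (Homeomorph.measurableEmbedding _)
          (fun p : Sph n × Set.Ioi (0 : ℝ) => g p.1 * A p.2.1)
        rw [hd] at this
        rw [← this]
        congr 1
        ext x
        rw [mul_comm, radialExt_of_ne g x.2, homeomorphUnitSphereProd_fst,
          homeomorphUnitSphereProd_apply_snd_coe]
    _ = (∫ σ, g σ ∂(surf n)) * ∫ r : Set.Ioi (0 : ℝ), A r ∂(Measure.volumeIoiPow n) :=
        integral_prod_mul g (fun r : Set.Ioi (0 : ℝ) => A r)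
    _ = _ := by
        congr 1
        simp only [Measure.volumeIoiPow, ENNReal.ofReal]
        rw [integral_withDensity_eq_integral_smul,
          integral_subtype_comap measurableSet_Ioi fun a ↦ Real.toNNReal (a ^ n) • A a,
          setIntegral_congr_fun measurableSet_Ioi fun x hx ↦ ?_]
        · rw [NNReal.smul_def, Real.coe_toNNReal _ (pow_nonneg hx.out.le _), smul_eq_mul]
        · exact (measurable_subtype_coe.pow_const _).real_toNNReal

theorem integrable_polar {A : ℝ → ℝ} {g : Sph n → ℝ} (hg : Integrable g (surf n))
    (hA : IntegrableOn (fun r : ℝ => r ^ n * A r) (Set.Ioi 0)) :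
    Integrable (fun x : Amb n => A ‖x‖ * radialExt g x) := by
  have hd : Module.finrank ℝ (Amb n) - 1 = n := by simp
  have h1 : Integrable (fun r : Set.Ioi (0 : ℝ) => A r) (Measure.volumeIoiPow n) := by
    rw [Measure.volumeIoiPow, integrable_withDensity_iff_integrable_smul']
    · rw [integrableOn_iff_comap_subtypeVal measurableSet_Ioi] at hA
      refine hA.congr (.of_forall fun r => ?_)
      simp [ENNReal.toReal_ofReal (pow_nonneg r.2.out.le n)]
    · fun_prop
    · simp
  have h2 := hg.mul_prod h1
  have := (volume : Measure (Amb n)).measurePreserving_homeomorphUnitSphereProd.integrable_comp_emb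
    (g := fun p : Sph n × Set.Ioi (0 : ℝ) => g p.1 * A p.2.1) (Homeomorph.measurableEmbedding _)
  rw [hd] at this
  have h3 := this.mpr h2
  rw [← restrict_compl_singleton (μ := (volume : Measure (Amb n))) 0, ← IntegrableOn,
    integrableOn_iff_comap_subtypeVal (measurableSet_singleton _).compl]
  refine h3.congr (.of_forall fun x => ?_)
  change _ = A ‖x.1‖ * radialExt g x.1
  rw [radialExt_of_ne g x.2, mul_comm]
  simp only [Function.comp_apply]
  rw [homeomorphUnitSphereProd_fst, homeomorphUnitSphereProd_apply_snd_coe]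

theorem fderiv_radialExt_smul (f : Sph n → ℝ) {c : ℝ} (hc : 0 < c) (x : Amb n) :
    fderiv ℝ (radialExt f) x = c • fderiv ℝ (radialExt f) (c • x) := by
  conv_lhs => rw [← radialExt_comp_smul f hc]
  exact fderiv_comp_smul c

/-- The derivative of a function of degree 0 is homogeneous of degree -1; this separates its radial
and angular parts. -/
theorem fderiv_radialExt_apply (f : Sph n → ℝ) {x : Amb n} (hx : x ≠ 0) (y : Amb n) :
    fderiv ℝ (radialExt f) x y = ‖x‖⁻¹ * radialExt (fun σ => ⟪sphGrad f σ, y⟫) x := by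
  rw [radialExt_of_ne _ hx, sphGrad, inner_gradient_left,
    fderiv_radialExt_smul f (inv_pos.mpr (norm_pos_iff.mpr hx))]
  simp [coe_dir]

/-- A smooth radial profile supported in `[1, 3]`. -/
def profile : ContDiffBump (2 : ℝ) where
  rIn := 1 / 2
  rOut := 1
  rIn_pos := by norm_num
  rIn_lt_rOut := by norm_num

theorem profile_eq_zero {r : ℝ} (hr : r ≤ 1) : profile r = 0 :=
  profile.zero_of_le_dist (by rw [Real.dist_eq, abs_of_nonpos] <;> simp [profile] <;> linarith)

theorem deriv_profile_eq_zero {r : ℝ} (hr : r < 1) : deriv profile r = 0 := by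
  have : profile =ᶠ[𝓝 r] fun _ => 0 := by
    filter_upwards [gt_mem_nhds hr] with s hs using profile_eq_zero (le_of_lt hs)
  rw [this.deriv_eq, deriv_const]

theorem hasFDerivAt_norm {x : Amb n} (hx : x ≠ 0) :
    HasFDerivAt (fun x : Amb n => ‖x‖) (‖x‖⁻¹ • innerSL ℝ x) x := by
  have h0 : HasFDerivAt (fun x : Amb n => ‖x‖ ^ 2) (2 • innerSL ℝ x) x :=
    (hasStrictFDerivAt_norm_sq x).hasFDerivAt
  have h1 := h0.sqrt (by simpa using hx)
  simp only [Real.sqrt_sq (norm_nonneg _)] at h1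
  refine h1.congr_fderiv ?_
  ext v
  simp
  ring

theorem hasFDerivAt_profile_norm (x : Amb n) : ∃ L : Amb n →L[ℝ] ℝ,
    HasFDerivAt (fun x : Amb n => profile ‖x‖) L x ∧
      ∀ y, L y = deriv profile ‖x‖ * radialExt (lin y) x := by
  rcases eq_or_ne x 0 with rfl | hx
  -- The norm is not differentiable at the origin, but the profile vanishes on the unit ball.
  · refine ⟨0, (hasFDerivAt_const (0 : ℝ) (0 : Amb n)).congr_of_eventuallyEq ?_, fun y => ?_⟩
    · filter_upwards [Metric.ball_mem_nhds (0 : Amb n) one_pos] with x hx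
      exact profile_eq_zero (by simpa using (le_of_lt (mem_ball_zero_iff.mp hx)))
    · simp [radialExt]
  · have hd : HasDerivAt profile (deriv profile ‖x‖) ‖x‖ :=
      (profile.contDiff (n := 1)).differentiable (by simp) |>.differentiableAt.hasDerivAt
    refine ⟨_, hd.comp_hasFDerivAt x (hasFDerivAt_norm hx), fun y => ?_⟩
    simp [radialExt_lin, real_inner_comm]

/-- Integration by parts on the whole line; the profile vanishes up to `1`, so restricting to `r >
0` changes nothing. The factor `n` here becomes the one in the divergence theorem. -/
theorem integral_deriv_profile (hn : 1 ≤ n) :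
    ∫ r in Set.Ioi (0 : ℝ), r ^ n * deriv profile r
      = -(n * ∫ r in Set.Ioi (0 : ℝ), r ^ n * (profile r * r⁻¹)) := by
  have hc : HasCompactSupport (profile : ℝ → ℝ) := profile.hasCompactSupport
  have hcd : Continuous (deriv profile) := (profile.contDiff (n := 1)).continuous_deriv (by simp)
  have h1 := integral_mul_deriv_eq_deriv_mul_of_integrable (u := fun r : ℝ => r ^ n)
    (u' := fun r => n * r ^ (n - 1)) (v := profile) (v' := deriv profile)
    (fun x _ => hasDerivAt_pow n x)
    (fun x _ => (profile.contDiff (n := 1)).differentiable (by simp) |>.differentiableAt.hasDerivAt)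
    (Continuous.integrable_of_hasCompactSupport (by fun_prop) hc.deriv.mul_left)
    (Continuous.integrable_of_hasCompactSupport
      (by have := profile.continuous; fun_prop) hc.mul_left)
    (Continuous.integrable_of_hasCompactSupport
      (by have := profile.continuous; fun_prop) hc.mul_left)
  rw [setIntegral_eq_integral_of_forall_compl_eq_zero, h1, ← integral_const_mul,
    ← setIntegral_eq_integral_of_forall_compl_eq_zero (s := Set.Ioi 0)]
  · congr 1
    refine setIntegral_congr_fun measurableSet_Ioi fun r (hr : 0 < r) => ?_
    obtain ⟨m, rfl⟩ := Nat.exists_eq_add_of_le' hn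
    simp only [Nat.add_sub_cancel]
    field_simp
    ring
  · intro r hr
    rw [profile_eq_zero (by simp at hr; linarith), mul_zero]
  · intro r hr
    rw [deriv_profile_eq_zero (by simp at hr; linarith), mul_zero]

theorem continuous_profile_mul_inv : Continuous fun r : ℝ => profile r * r⁻¹ := by
  refine continuous_iff_continuousAt.mpr fun r => ?_
  rcases lt_or_ge r 1 with hr | hr
  · refine (continuousAt_const (y := (0 : ℝ))).congr ?_
    filter_upwards [gt_mem_nhds hr] with s hs
    simp [profile_eq_zero (le_of_lt hs)]
  · exact profile.continuous.continuousAt.mul (continuousAt_inv₀ (by linarith))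

theorem integral_profile_pos : 0 < ∫ r in Set.Ioi (0 : ℝ), r ^ n * (profile r * r⁻¹) := by
  have hc : HasCompactSupport (profile : ℝ → ℝ) := profile.hasCompactSupport
  rw [setIntegral_eq_integral_of_forall_compl_eq_zero]
  · refine Continuous.integral_pos_of_hasCompactSupport_nonneg_nonzero (x := 2)
      (by have := continuous_profile_mul_inv; fun_prop) (hc.mul_right.mul_left) (fun r => ?_) ?_
    · rcases le_or_gt r 1 with hr | hr
      · simp [profile_eq_zero hr]
      · have := profile.nonneg' r
        have : 0 < r := by linarith
        positivity
    · have : profile 2 = 1 := profile.one_of_mem_closedBall (by simp [profile])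
      simp [this]
  · intro r hr
    rw [profile_eq_zero (by simp at hr; linarith), zero_mul, mul_zero]

theorem integrable_surf {g : Sph n → ℝ} (hg : Continuous g) : Integrable g (surf n) :=
  hg.integrable_of_hasCompactSupport (HasCompactSupport.of_compactSpace g)

/-- The directional derivative along `y` of `profile ‖x‖ * radialExt f x` has integral zero over
`ℝ^N`. Polar coordinates split its two terms into radial times angular integrals; the common radial
factor is positive and cancels. The right side is the mean curvature term of the sphere. -/
theorem integral_inner_sphGrad_surf (hn : 1 ≤ n) {f : Sph n → ℝ} (hf : Smooth f) (y : Amb n) :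
    ∫ σ, ⟪sphGrad f σ, y⟫ ∂(surf n) = n * ∫ σ, f σ * lin y σ ∂(surf n) := by
  have hc : HasCompactSupport (profile : ℝ → ℝ) := profile.hasCompactSupport
  have hcd : Continuous (deriv profile) := (profile.contDiff (n := 1)).continuous_deriv (by simp)
  have hci := continuous_profile_mul_inv
  have hpc : Continuous (profile : ℝ → ℝ) := profile.continuous
  have e1 : ∀ x : Amb n, profile ‖x‖ * fderiv ℝ (radialExt f) x y
      = (profile ‖x‖ * ‖x‖⁻¹) * radialExt (fun σ => ⟪sphGrad f σ, y⟫) x := by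
    intro x
    rcases eq_or_ne x 0 with rfl | hx
    · simp [profile_eq_zero]
    · rw [fderiv_radialExt_apply f hx, mul_assoc]
  have e2 : ∀ x : Amb n, fderiv ℝ (fun x : Amb n => profile ‖x‖) x y * radialExt f x
      = deriv profile ‖x‖ * radialExt (fun σ => f σ * lin y σ) x := by
    intro x
    obtain ⟨L, hL, hLy⟩ := hasFDerivAt_profile_norm x
    rw [hL.fderiv, hLy, radialExt_mul]
    ring
  have hgc : Continuous fun σ => ⟪sphGrad f σ, y⟫ := hf.continuous_sphGrad.inner continuous_const
  have hts : ∀ x ∈ tsupport (fun x : Amb n => profile ‖x‖), x ≠ 0 := by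
    rintro x hx rfl
    refine absurd hx (notMem_tsupport_iff_eventuallyEq.mpr ?_)
    filter_upwards [Metric.ball_mem_nhds (0 : Amb n) one_pos] with x hx
    exact profile_eq_zero (by simpa using (le_of_lt (mem_ball_zero_iff.mp hx)))
  have key := integral_mul_fderiv_eq_neg_fderiv_mul_of_integrable (μ := volume)
    (f := fun x : Amb n => profile ‖x‖) (g := radialExt f) (v := y) ?_ ?_ ?_
    (fun x _ => (hasFDerivAt_profile_norm x).choose_spec.1.differentiableAt)
    (fun x hx => (hf.contDiffAt (hts x hx)).differentiableAt (by simp))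
  · simp only [e1, e2] at key
    rw [integral_polar (fun r => profile r * r⁻¹), integral_polar, integral_deriv_profile hn] at key
    have hp := integral_profile_pos (n := n)
    refine mul_right_cancel₀ hp.ne' ?_
    rw [key]
    ring
  · simp only [e2]
    refine integrable_polar (integrable_surf (hf.continuous.mul (smooth_lin y).continuous)) ?_
    exact (Continuous.integrable_of_hasCompactSupport (by fun_prop) hc.deriv.mul_left).integrableOn
  · simp only [e1]
    refine integrable_polar (A := fun r => profile r * r⁻¹) (integrable_surf hgc) ?_
    have h : Continuous fun r : ℝ => r ^ n * (profile r * r⁻¹) := by fun_prop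
    exact (h.integrable_of_hasCompactSupport hc.mul_right.mul_left).integrableOn
  · refine integrable_polar (A := profile) (integrable_surf hf.continuous) ?_
    exact (Continuous.integrable_of_hasCompactSupport (by fun_prop) hc.mul_left).integrableOn

/-! ### Green's formula on the sphere -/

/-- The component of the tangential gradient along a fixed vector. -/
def partialSph (y : Amb n) (f : Sph n → ℝ) (σ : Sph n) : ℝ := ⟪sphGrad f σ, y⟫

/-- The factor `‖x‖` restores degree 0, so components of the gradient can be differentiated again as
functions on the sphere. -/
theorem radialExt_partialSph (y : Amb n) (f : Sph n → ℝ) {x : Amb n} (hx : x ≠ 0) :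
    radialExt (partialSph y f) x = ‖x‖ * fderiv ℝ (radialExt f) x y := by
  have h : ‖x‖ ≠ 0 := norm_ne_zero_iff.mpr hx
  rw [fderiv_radialExt_apply f hx, ← mul_assoc, mul_inv_cancel₀ h, one_mul]
  rfl

theorem Smooth.partialSph {f : Sph n → ℝ} (hf : Smooth f) (y : Amb n) :
    Smooth (partialSph y f) := by
  intro σ
  have h1 : ContDiffAt ℝ ∞ (fun x : Amb n => ‖x‖ * fderiv ℝ (radialExt f) x y) (σ : Amb n) :=
    (contDiffAt_norm ℝ (sph_ne_zero σ)).mul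
      ((ContDiffAt.fderiv_right (m := ∞) (hf σ) (by simp)).clm_apply contDiffAt_const)
  refine h1.congr_of_eventuallyEq ?_
  filter_upwards [eventually_ne_zero σ] with x hx using radialExt_partialSph y f hx

theorem inner_sphGrad_partialSph {f : Sph n → ℝ} {σ : Sph n} (hf : SmoothAt f σ) (y v : Amb n) :
    ⟪sphGrad (partialSph y f) σ, v⟫
      = ⟪(σ : Amb n), v⟫ * partialSph y f σ
        + fderiv ℝ (fderiv ℝ (radialExt f)) (σ : Amb n) v y := by
  have h0 : DifferentiableAt ℝ (fderiv ℝ (radialExt f)) (σ : Amb n) :=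
    (ContDiffAt.fderiv_right (m := 1) hf (by norm_cast)).differentiableAt (by simp)
  have h1 := (hasFDerivAt_norm (sph_ne_zero σ)).fun_mul
    (h0.hasFDerivAt.clm_apply (hasFDerivAt_const y (σ : Amb n)))
  have h2 : radialExt (partialSph y f) =ᶠ[𝓝 (σ : Amb n)]
      fun x : Amb n => ‖x‖ * fderiv ℝ (radialExt f) x y := by
    filter_upwards [eventually_ne_zero σ] with x hx using radialExt_partialSph y f hx
  rw [sphGrad, inner_gradient_left, h2.fderiv_eq, h1.fderiv]
  simp [partialSph, sphGrad, inner_gradient_left]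
  ring

/-- Differentiating the factor `‖x‖` of each component adds terms whose sum is `⟪σ, ∇'f⟫ = 0`; what
remains is the trace of the Hessian of the extension. -/
theorem sphLap_eq_sum {f : Sph n → ℝ} {σ : Sph n} (hf : SmoothAt f σ) :
    sphLap f σ = ∑ i, ⟪sphGrad (partialSph (EuclideanSpace.basisFun (Fin (n + 1)) ℝ i) f) σ,
      EuclideanSpace.basisFun (Fin (n + 1)) ℝ i⟫ := by
  simp only [inner_sphGrad_partialSph hf, Finset.sum_add_distrib]
  have h1 : ∑ i, ⟪(σ : Amb n), EuclideanSpace.basisFun (Fin (n + 1)) ℝ i⟫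
      * partialSph (EuclideanSpace.basisFun (Fin (n + 1)) ℝ i) f σ = 0 := by
    rw [← inner_sphGrad_self f σ, real_inner_comm,
      ← (EuclideanSpace.basisFun (Fin (n + 1)) ℝ).sum_inner_mul_inner]
    refine Finset.sum_congr rfl fun i _ => ?_
    rw [partialSph, real_inner_comm (sphGrad f σ)]
  rw [h1, zero_add, sphLap,
    InnerProductSpace.laplacian_eq_iteratedFDeriv_orthonormalBasis _
      (EuclideanSpace.basisFun (Fin (n + 1)) ℝ)]
  simp [iteratedFDeriv_two_apply]

theorem IsTest.partialSph {f : Sph n → ℝ} (hf : IsTest f) (y : Amb n) :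
    IsTest (partialSph y f) := by
  refine ⟨smooth_iff.mp (hf.smooth.partialSph y), ?_⟩
  refine (closure_minimal (fun σ hσ => ?_) (isClosed_tsupport f)).trans hf.2
  by_contra h
  exact hσ (by rw [HardySphere.partialSph, (hasSphGrad_zero_of_notMem_tsupport h).eq,
    inner_zero_left])

theorem isTest_zero : IsTest (fun _ : Sph n => (0 : ℝ)) := by
  refine ⟨smooth_iff.mp (smoothAt_const 0), ?_⟩
  simp [tsupport]

theorem isTest_sum {ι : Type*} (s : Finset ι) (f : ι → Sph n → ℝ) (hf : ∀ i, IsTest (f i)) :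
    IsTest (fun σ => ∑ i ∈ s, f i σ) := by
  classical
  induction s using Finset.induction_on with
  | empty => simpa using isTest_zero
  | insert i s hi ih => simpa [Finset.sum_insert hi] using (hf i).add ih

theorem IsTest.sphLap {f : Sph n → ℝ} (hf : IsTest f) : IsTest (sphLap f) := by
  have h : HardySphere.sphLap f = _ := funext fun σ => sphLap_eq_sum (hf.smooth σ)
  rw [h]
  exact isTest_sum _ _ fun i => (hf.partialSph _).partialSph _

theorem HasSphGrad.sphGrad_mul {f g : Sph n → ℝ} {F G : Amb n} {σ : Sph n} (hf : HasSphGrad f F σ)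
    (hg : HasSphGrad g G σ) : sphGrad (fun τ => f τ * g τ) σ = f σ • G + g σ • F := (hf.mul hg).eq

theorem sphGrad_mul {f g : Sph n → ℝ} {σ : Sph n} (hf : SmoothAt f σ)
    (hg : SmoothAt g σ) : sphGrad (fun τ => f τ * g τ) σ = f σ • sphGrad g σ + g σ • sphGrad f σ :=
  hf.hasSphGrad.sphGrad_mul hg.hasSphGrad

theorem sphGrad_lin (y : Amb n) (σ : Sph n) : sphGrad (lin y) σ = y - lin y σ • (σ : Amb n) :=
  (hasSphGrad_lin y σ).eq

theorem inner_sphGrad_sphGrad_lin (f : Sph n → ℝ) (y : Amb n) (σ : Sph n) :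
    ⟪sphGrad f σ, sphGrad (lin y) σ⟫ = ⟪sphGrad f σ, y⟫ := by
  rw [sphGrad_lin, inner_sub_right, inner_smul_right, inner_sphGrad_self]; ring

/-- Green's formula on the sphere. -/
theorem integral_mul_sphLap_surf (hn : 1 ≤ n) {f g : Sph n → ℝ} (hf : Smooth f) (hg : Smooth g) :
    ∫ σ, f σ * sphLap g σ ∂(surf n) = -∫ σ, ⟪sphGrad f σ, sphGrad g σ⟫ ∂(surf n) := by
  let e := EuclideanSpace.basisFun (Fin (n + 1)) ℝ
  have hs : ∀ i, Smooth (fun σ => f σ * partialSph (e i) g σ) := fun i σ =>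
    (hf σ).mul (hg.partialSph (e i) σ)
  have h1 : ∀ i, ∫ σ, ⟪sphGrad (fun σ => f σ * partialSph (e i) g σ) σ, e i⟫ ∂(surf n)
      = n * ∫ σ, f σ * partialSph (e i) g σ * lin (e i) σ ∂(surf n) := fun i =>
    integral_inner_sphGrad_surf hn (hs i) (e i)
  -- The curvature terms add up to `n ∫ f ⟪∇'g, σ⟫`, which vanishes because `∇'g` is tangential.
  have h2 : ∑ i, ∫ σ, ⟪sphGrad (fun σ => f σ * partialSph (e i) g σ) σ, e i⟫ ∂(surf n) = 0 := by
    rw [Finset.sum_congr rfl fun i _ => h1 i, ← Finset.mul_sum,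
      ← integral_finsetSum _ fun i _ => integrable_surf
        ((hs i).continuous.fun_mul (smooth_lin (e i)).continuous)]
    have : ∀ σ : Sph n, ∑ i, f σ * partialSph (e i) g σ * lin (e i) σ = 0 := fun σ => by
      simp only [mul_assoc]
      rw [← Finset.mul_sum]
      have := e.sum_inner_mul_inner (sphGrad g σ) (σ : Amb n)
      rw [inner_sphGrad_self] at this
      rw [show ∑ i, partialSph (e i) g σ * lin (e i) σ = 0 from this, mul_zero]
    simp [this]
  rw [← integral_finsetSum _ fun i _ => integrable_surf
    ((hs i).continuous_sphGrad.inner continuous_const)] at h2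
  have h3 : ∀ σ : Sph n, ∑ i, ⟪sphGrad (fun σ => f σ * partialSph (e i) g σ) σ, e i⟫
      = f σ * sphLap g σ + ⟪sphGrad f σ, sphGrad g σ⟫ := fun σ => by
    have : ∀ i, ⟪sphGrad (fun σ => f σ * partialSph (e i) g σ) σ, e i⟫
        = f σ * ⟪sphGrad (partialSph (e i) g) σ, e i⟫
          + ⟪sphGrad f σ, e i⟫ * ⟪e i, sphGrad g σ⟫ := fun i => by
      rw [sphGrad_mul (hf σ) (hg.partialSph (e i) σ), inner_add_left, inner_smul_left,
        inner_smul_left, real_inner_comm (sphGrad g σ)]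
      simp [partialSph]
      ring
    simp only [this, Finset.sum_add_distrib, ← Finset.mul_sum, e.sum_inner_mul_inner]
    rw [sphLap_eq_sum (hg σ)]
  simp only [h3] at h2
  have hL : Continuous (sphLap g) := by
    have h : sphLap g = _ := funext fun σ => sphLap_eq_sum (hg σ)
    rw [h]
    exact continuous_finsetSum _ fun i _ =>
      (hg.partialSph _).continuous_sphGrad.inner continuous_const
  rw [integral_add (integrable_surf (hf.continuous.fun_mul hL)) (integrable_surf
    (hf.continuous_sphGrad.inner hg.continuous_sphGrad))] at h2
  linarith

/-! ### Integration over the half-sphere -/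

theorem measurableSet_upper : MeasurableSet (upper n) := isOpen_upper.measurableSet

instance : IsFiniteMeasure (dS n) := by unfold dS; infer_instance

theorem ae_mem_upper : ∀ᵐ σ ∂(dS n), σ ∈ upper n := ae_restrict_mem measurableSet_upper

theorem height_le_one (σ : Sph n) : height σ ≤ 1 := by
  rw [height_eq_lin, lin]
  refine (real_inner_le_norm _ _).trans ?_
  simp

theorem one_le_alphaPlus (κ : ℝ) : 1 ≤ alphaPlus κ := by
  have := Real.sqrt_nonneg (1 - 4 * κ); unfold alphaPlus; linarith

/-- The indicial equation, which makes the `h⁻²` terms cancel in the ground state representation. -/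
theorem eq_of_alphaPlus {κ : ℝ} (hκ : κ ≤ 1 / 4) :
    κ = alphaPlus κ / 2 - (alphaPlus κ / 2) ^ 2 := by
  have := Real.sq_sqrt (show 0 ≤ 1 - 4 * κ by linarith)
  unfold alphaPlus; linarith

theorem rho_pos (κ : ℝ) {σ : Sph n} (hσ : σ ∈ upper n) : 0 < rho κ σ := Real.rpow_pos_of_pos hσ _

theorem rho_sq (κ : ℝ) {σ : Sph n} (hσ : σ ∈ upper n) : rho κ σ ^ 2 = height σ ^ alphaPlus κ := by
  rw [rho, ← Real.rpow_natCast, ← Real.rpow_mul (le_of_lt hσ)]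
  norm_num

theorem measurable_rho (κ : ℝ) : Measurable (rho (n := n) κ) :=
  continuous_height.measurable.pow_const _

theorem rho_le_one (κ : ℝ) {σ : Sph n} (hσ : σ ∈ upper n) : rho κ σ ≤ 1 :=
  Real.rpow_le_one (le_of_lt hσ) (height_le_one σ) (by have := one_le_alphaPlus κ; linarith)

theorem weighted_le (κ : ℝ) : weighted n κ ≤ dS n := by
  refine (withDensity_mono (g := 1) ?_).trans (by simp)
  filter_upwards [ae_mem_upper] with σ hσ
  rw [Pi.one_apply, ENNReal.ofReal_le_one]
  exact pow_le_one₀ (rho_pos κ hσ).le (rho_le_one κ hσ)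

instance (κ : ℝ) : IsFiniteMeasure (weighted n κ) := isFiniteMeasure_of_le _ (weighted_le κ)

theorem dS_absolutelyContinuous_weighted (κ : ℝ) : dS n ≪ weighted n κ := by
  refine withDensity_absolutelyContinuous' ?_ ?_
  · exact ((measurable_rho κ).pow_const 2).ennreal_ofReal.aemeasurable
  · filter_upwards [ae_mem_upper] with σ hσ
    simpa using (rho_pos κ hσ).ne'

theorem weighted_absolutelyContinuous_dS (κ : ℝ) : weighted n κ ≪ dS n :=
  Measure.absolutelyContinuous_of_le (weighted_le κ)

theorem ae_weighted_mem_upper (κ : ℝ) : ∀ᵐ σ ∂(weighted n κ), σ ∈ upper n :=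
  (weighted_absolutelyContinuous_dS κ).ae_le ae_mem_upper

theorem integral_weighted (κ : ℝ) (f : Sph n → ℝ) :
    ∫ σ, f σ ∂(weighted n κ) = ∫ σ, rho κ σ ^ 2 * f σ ∂(dS n) := by
  rw [weighted, integral_withDensity_eq_integral_toReal_smul
    (((measurable_rho κ).pow_const 2).ennreal_ofReal) (by simp)]
  refine integral_congr_ae (.of_forall fun σ => ?_)
  simp [ENNReal.toReal_ofReal (sq_nonneg (rho κ σ))]

theorem integral_dS_eq_surf {f : Sph n → ℝ} (hf : ∀ σ, σ ∉ upper n → f σ = 0) :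
    ∫ σ, f σ ∂(dS n) = ∫ σ, f σ ∂(surf n) :=
  setIntegral_eq_integral_of_forall_compl_eq_zero hf

theorem IsTest.continuous {f : Sph n → ℝ} (hf : IsTest f) : Continuous f := hf.smooth.continuous

theorem integrable_of_continuous {μ : Measure (Sph n)} [IsFiniteMeasure μ] {E : Type*}
    [NormedAddCommGroup E] {f : Sph n → E} (hf : Continuous f) : Integrable f μ :=
  hf.integrable_of_hasCompactSupport (HasCompactSupport.of_compactSpace f)

theorem IsTest.integrable {μ : Measure (Sph n)} [IsFiniteMeasure μ] {f : Sph n → ℝ}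
    (hf : IsTest f) : Integrable f μ := integrable_of_continuous hf.continuous

theorem IsTest.rpow_mul {f : Sph n → ℝ} (hf : IsTest f) (p : ℝ) :
    IsTest (fun σ => height σ ^ p * f σ) := hf.mul_left fun _ hσ => smoothAt_height_rpow p hσ

theorem IsTest.rho_mul {f : Sph n → ℝ} (hf : IsTest f) (κ : ℝ) :
    IsTest (fun σ => rho κ σ * f σ) := hf.rpow_mul _

theorem IsTest.smooth_mul {f η : Sph n → ℝ} (hη : IsTest η) (hf : Smooth f) :
    IsTest (fun σ => f σ * η σ) := hη.mul_left fun σ _ => hf σ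

theorem IsTest.const_mul {η : Sph n → ℝ} (hη : IsTest η) (c : ℝ) :
    IsTest (fun σ => c * η σ) := hη.smooth_mul (smoothAt_const c)

theorem IsTest.inner_sphGrad {f g : Sph n → ℝ} (hf : IsTest f) (hg : Smooth g) :
    IsTest (fun σ => ⟪sphGrad f σ, sphGrad g σ⟫) := by
  have h : (fun σ : Sph n => ⟪sphGrad f σ, sphGrad g σ⟫) = fun σ =>
      ∑ i, HardySphere.partialSph (EuclideanSpace.basisFun (Fin (n + 1)) ℝ i) g σ *
        HardySphere.partialSph (EuclideanSpace.basisFun (Fin (n + 1)) ℝ i) f σ := by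
    ext σ
    rw [← (EuclideanSpace.basisFun (Fin (n + 1)) ℝ).sum_inner_mul_inner]
    refine Finset.sum_congr rfl fun i _ => ?_
    rw [mul_comm, real_inner_comm]
    rfl
  rw [h]
  exact isTest_sum _ _ fun i => (hf.partialSph _).smooth_mul (hg.partialSph _)

/-! ### Divergence theorem for weights that are powers of the height -/

/-- The last vector `e_N` of the canonical basis. -/
abbrev eN (n : ℕ) : Amb n := EuclideanSpace.single (Fin.last n) 1

theorem inner_eN (y : Amb n) : ⟪eN n, y⟫ = y (Fin.last n) := by
  simp [EuclideanSpace.inner_single_left]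

/-- The divergence theorem for the field `h ^ p η y`, with `h` the height. -/
theorem integral_rpow_partialSph (hn : 1 ≤ n) {η : Sph n → ℝ} (hη : IsTest η) (p : ℝ)
    (y : Amb n) :
    ∫ σ, height σ ^ p * ⟪sphGrad η σ, y⟫ + p * height σ ^ (p - 1) * η σ *
        (y (Fin.last n) - height σ * lin y σ) - n * (height σ ^ p * η σ * lin y σ) ∂(dS n) = 0 := by
  have hf := hη.rpow_mul p
  have h := integral_inner_sphGrad_surf hn hf.smooth y
  rw [← integral_dS_eq_surf (fun σ hσ => by rw [hf.sphGrad_zero hσ, inner_zero_left]),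
    ← integral_dS_eq_surf (fun σ hσ => by
      simp [hη.zero_of_notMem hσ]), ← integral_const_mul, ← sub_eq_zero, ← integral_sub] at h
  · rw [← h]
    refine integral_congr_ae ?_
    filter_upwards [ae_mem_upper] with σ hσ
    have h1 := (hasSphGrad_height_rpow p hσ).sphGrad_mul (hη.smooth σ).hasSphGrad
    simp only [h1, inner_add_left, inner_smul_left, inner_sub_left, inner_eN]
    simp only [lin, conj_trivial, real_inner_comm y]
    ring
  · exact (hf.partialSph y).integrable
  · exact integrable_of_continuous
      (continuous_const.fun_mul (hf.continuous.fun_mul (smooth_lin y).continuous))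

/-- The case `p = α₊`. For horizontal `y` the derivative of the weight along `y` is `-α₊ h^α₊ ⟪y,
σ⟫`: no singular power of the height appears, and the constant `n` becomes `n + α₊`. -/
theorem integral_weighted_partialSph (hn : 1 ≤ n) (κ : ℝ) {η : Sph n → ℝ} (hη : IsTest η)
    {y : Amb n} (hy : y (Fin.last n) = 0) :
    ∫ σ, ⟪sphGrad η σ, y⟫ ∂(weighted n κ)
      = (n + alphaPlus κ) * ∫ σ, η σ * lin y σ ∂(weighted n κ) := by
  rw [← sub_eq_zero, ← integral_const_mul, ← integral_sub, integral_weighted,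
    ← integral_rpow_partialSph hn hη (alphaPlus κ) y]
  · refine integral_congr_ae ?_
    filter_upwards [ae_mem_upper] with σ hσ
    have h0 : (0 : ℝ) < height σ := hσ
    simp only [rho_sq κ hσ, hy, Real.rpow_sub_one h0.ne']
    field_simp
    ring
  · exact (hη.partialSph y).integrable
  · exact integrable_of_continuous
      (continuous_const.fun_mul (hη.continuous.fun_mul (smooth_lin y).continuous))

theorem Smooth.pow {f : Sph n → ℝ} (hf : Smooth f) (m : ℕ) : Smooth (fun σ => f σ ^ m) :=
  fun σ => SmoothAt.comp (F := fun t => t ^ m) (contDiff_id.pow m).contDiffAt (hf σ)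

theorem sphGrad_pow {f : Sph n → ℝ} (hf : Smooth f) (m : ℕ) (σ : Sph n) :
    sphGrad (fun σ => f σ ^ m) σ = (m * f σ ^ (m - 1)) • sphGrad f σ :=
  (HasSphGrad.comp (F := fun t => t ^ m) (hasDerivAt_pow m (f σ)) (hf σ).hasSphGrad).eq

/-- The weighted Laplacian of a power of a linear form. -/
def powLap (κ : ℝ) (y : Amb n) (m : ℕ) (σ : Sph n) : ℝ :=
  (m + 1) * ((n + alphaPlus κ + m) * lin y σ ^ (m + 1) - m * ‖y‖ ^ 2 * lin y σ ^ (m - 1))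

theorem continuous_lin (y : Amb n) : Continuous (lin y) := (smooth_lin y).continuous

theorem continuous_powLap (κ : ℝ) (y : Amb n) (m : ℕ) : Continuous (powLap κ y m) := by
  have := continuous_lin y
  unfold powLap; fun_prop

/-- The weighted divergence theorem applied to `⟪y, σ⟫^m η`, together with `|∇'⟪y, σ⟫|² = ‖y‖² - ⟪y,
σ⟫²`. -/
theorem integral_inner_sphGrad_lin_pow (hn : 1 ≤ n) (κ : ℝ) {η : Sph n → ℝ} (hη : IsTest η)
    {y : Amb n} (hy : y (Fin.last n) = 0) (m : ℕ) :
    ∫ σ, ⟪sphGrad η σ, sphGrad (fun σ => lin y σ ^ (m + 1)) σ⟫ ∂(weighted n κ)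
      = ∫ σ, η σ * powLap κ y m σ ∂(weighted n κ) := by
  have hl := smooth_lin y
  have hlc := continuous_lin y
  have hf : IsTest (fun σ => lin y σ ^ m * η σ) := hη.smooth_mul (hl.pow m)
  have h := integral_weighted_partialSph hn κ hf hy
  have hfi : Integrable (fun σ => ⟪sphGrad (fun σ => lin y σ ^ m * η σ) σ, y⟫) (weighted n κ) :=
    (hf.partialSph y).integrable
  rw [← sub_eq_zero, ← integral_const_mul, ← integral_sub hfi
    (integrable_of_continuous (continuous_const.fun_mul (hf.continuous.fun_mul hlc)))] at h
  rw [← sub_eq_zero, ← integral_sub (hη.inner_sphGrad (hl.pow _)).integrable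
    (integrable_of_continuous (hη.continuous.fun_mul (continuous_powLap κ y m))),
    ← mul_zero ((m : ℝ) + 1), ← h, ← integral_const_mul]
  refine integral_congr_ae (.of_forall fun σ => ?_)
  have h1 := sphGrad_mul (hl.pow m σ) (hη.smooth σ)
  have h2 : ⟪sphGrad (lin y) σ, y⟫ = ‖y‖ ^ 2 - lin y σ ^ 2 := by
    rw [sphGrad_lin, inner_sub_left, inner_smul_left, real_inner_self_eq_norm_sq]
    simp only [lin, conj_trivial, real_inner_comm y]
    ring
  simp only [h1, sphGrad_pow hl, inner_smul_right, inner_add_left, inner_smul_left,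
    inner_sphGrad_sphGrad_lin, h2, powLap, conj_trivial]
  rcases m with _ | m
  · simp; ring
  · simp only [Nat.add_sub_cancel]
    push_cast
    ring

/-! ### The ground state substitution -/

theorem hasSphGrad_rho (κ : ℝ) {σ : Sph n} (hσ : σ ∈ upper n) :
    HasSphGrad (rho κ) ((alphaPlus κ / 2 * (rho κ σ / height σ)) • sphGrad height σ) σ := by
  have := hasSphGrad_height_rpow (alphaPlus κ / 2) hσ
  rw [(hasSphGrad_height σ).eq]
  rwa [Real.rpow_sub_one (ne_of_gt hσ)] at this

theorem norm_sphGrad_height_sq (σ : Sph n) : ‖sphGrad height σ‖ ^ 2 = 1 - height σ ^ 2 := by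
  have h := inner_sphGrad_self height σ
  rw [← real_inner_self_eq_norm_sq]
  nth_rw 2 [(hasSphGrad_height σ).eq]
  rw [inner_sub_right, inner_smul_right, h, (hasSphGrad_height σ).eq, inner_sub_left,
    inner_smul_left, real_inner_comm (eN n), inner_eN, real_inner_comm, inner_eN]
  simp [height]
  ring

theorem inner_sphGrad_height (f : Sph n → ℝ) (σ : Sph n) :
    ⟪sphGrad f σ, sphGrad height σ⟫ = ⟪sphGrad f σ, eN n⟫ := by
  rw [(hasSphGrad_height σ).eq, inner_sub_right, inner_smul_right, inner_sphGrad_self]; ring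

theorem IsTest.hardy {φ η : Sph n → ℝ} (hφ : IsTest φ) (hη : IsTest η) (κ : ℝ) :
    IsTest (fun σ => κ * (height σ ^ 2)⁻¹ * (φ σ * η σ)) := by
  have := ((hη.smooth_mul hφ.smooth).rpow_mul (-2)).const_mul κ
  have e : (fun σ => κ * (height σ ^ 2)⁻¹ * (φ σ * η σ))
      = fun σ => κ * (height σ ^ (-2 : ℝ) * (φ σ * η σ)) := by
    ext σ
    by_cases hσ : σ ∈ upper n
    · rw [Real.rpow_neg (le_of_lt hσ)]; norm_cast; ring
    · simp [hφ.zero_of_notMem hσ]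
  rwa [e]

/-- The ground state representation of the Hardy form. -/
theorem integral_ground_state (hn : 1 ≤ n) {κ : ℝ} (hκ : κ ≤ 1 / 4) {φ η : Sph n → ℝ}
    (hφ : IsTest φ) (hη : IsTest η) :
    ∫ σ, ⟪sphGrad (fun σ => rho κ σ * φ σ) σ, sphGrad (fun σ => rho κ σ * η σ) σ⟫
        - κ * (height σ ^ 2)⁻¹ * ((rho κ σ * φ σ) * (rho κ σ * η σ)) ∂(dS n)
      = ∫ σ, ⟪sphGrad φ σ, sphGrad η σ⟫ + mu1 (n + 1) κ * (φ σ * η σ) ∂(weighted n κ) := by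
  have hξ : IsTest (fun σ => φ σ * η σ) := hη.smooth_mul hφ.smooth
  -- The cross term is `ρ ⟪∇'ρ, ∇'(φη)⟫ = (α₊/2) h^(α₊-1) ⟪e_N, ∇'(φη)⟫`, so the divergence theorem
  -- is needed for the exponent `α₊ - 1` and is used `α₊/2` times.
  have h := integral_rpow_partialSph hn hξ (alphaPlus κ - 1) (eN n)
  have hF := hφ.rho_mul κ
  have hH := hη.rho_mul κ
  have hR : IsTest (fun σ => rho κ σ * (rho κ σ *
      (⟪sphGrad φ σ, sphGrad η σ⟫ + mu1 (n + 1) κ * (φ σ * η σ)))) :=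
    (((hφ.inner_sphGrad hη.smooth).add (hξ.const_mul _)).rho_mul κ).rho_mul κ
  simp only [← mul_assoc, ← sq] at hR
  have hL : Integrable (fun σ =>
      ⟪sphGrad (fun σ => rho κ σ * φ σ) σ, sphGrad (fun σ => rho κ σ * η σ) σ⟫
        - κ * (height σ ^ 2)⁻¹ * ((rho κ σ * φ σ) * (rho κ σ * η σ))) (dS n) :=
    (hF.inner_sphGrad hH.smooth).integrable.sub (hF.hardy hH κ).integrable
  rw [integral_weighted, ← sub_eq_zero, ← integral_sub hL
    (by simpa only [← mul_assoc] using hR.integrable),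
    ← mul_zero (alphaPlus κ / 2), ← h, ← integral_const_mul]
  refine integral_congr_ae ?_
  filter_upwards [ae_mem_upper] with σ hσ
  have h0 : (0 : ℝ) < height σ := hσ
  have e1 := (hasSphGrad_rho κ hσ).sphGrad_mul (hφ.smooth σ).hasSphGrad
  have e2 := (hasSphGrad_rho κ hσ).sphGrad_mul (hη.smooth σ).hasSphGrad
  have e3 := sphGrad_mul (hφ.smooth σ) (hη.smooth σ)
  have e4 : lin (eN n) σ = height σ := (height_eq_lin σ).symm
  have e5 : (eN n) (Fin.last n) = 1 := by simp
  rw [e1, e2, e3, e4, e5]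
  simp only [Real.rpow_sub_one h0.ne', ← rho_sq κ hσ, inner_add_left, inner_add_right,
    inner_smul_left, inner_smul_right, conj_trivial,
    real_inner_self_eq_norm_sq, norm_sphGrad_height_sq, inner_sphGrad_height,
    real_inner_comm (sphGrad η σ) (sphGrad height σ), mu1]
  set r := rho κ σ
  -- With `κ = a - a²` the coefficient of `h⁻²` is `a² - κ - a(2a - 1) = 0`, and the constant left
  -- is `a² + (n-1)a`, which is `μ₁`.
  have hκ' := eq_of_alphaPlus hκ
  set a := alphaPlus κ / 2 with ha
  have ha2 : alphaPlus κ = 2 * a := by rw [ha]; ring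
  rw [ha2]
  generalize κ = k at hκ'
  subst hκ'
  push_cast
  field_simp
  ring

/-! ### Convergence in `L²` -/

section L2

variable {α : Type*} [MeasurableSpace α] {μ : Measure α}
variable {E : Type*} [NormedAddCommGroup E]

theorem tendsto_eLpNorm_two_zero {f : ℕ → α → E} (hf : ∀ k, MemLp (f k) 2 μ)
    (h : Tendsto (fun k => ∫ x, ‖f k x‖ ^ 2 ∂μ) atTop (𝓝 0)) :
    Tendsto (fun k => eLpNorm (f k) 2 μ) atTop (𝓝 0) := by
  have e : ∀ k, eLpNorm (f k) 2 μ
      = ENNReal.ofReal (Real.sqrt (∫ x, ‖f k x‖ ^ 2 ∂μ)) := fun k => by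
    rw [(hf k).eLpNorm_eq_integral_rpow_norm (by simp) (by simp), Real.sqrt_eq_rpow]
    simp
  simp only [e]
  have := ENNReal.tendsto_ofReal ((Real.continuous_sqrt.tendsto 0).comp h)
  simpa using this

variable [InnerProductSpace ℝ E]

theorem tendsto_integral_inner {f g : ℕ → α → E} {f₀ g₀ : α → E}
    (hf : ∀ k, MemLp (f k) 2 μ) (hg : ∀ k, MemLp (g k) 2 μ) (hf₀ : MemLp f₀ 2 μ)
    (hg₀ : MemLp g₀ 2 μ)
    (h1 : Tendsto (fun k => eLpNorm (fun x => f k x - f₀ x) 2 μ) atTop (𝓝 0))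
    (h2 : Tendsto (fun k => eLpNorm (fun x => g k x - g₀ x) 2 μ) atTop (𝓝 0)) :
    Tendsto (fun k => ∫ x, ⟪f k x, g k x⟫ ∂μ) atTop (𝓝 (∫ x, ⟪f₀ x, g₀ x⟫ ∂μ)) := by
  have a1 := (Lp.tendsto_Lp_iff_tendsto_eLpNorm'' f hf f₀ hf₀).mpr h1
  have a2 := (Lp.tendsto_Lp_iff_tendsto_eLpNorm'' g hg g₀ hg₀).mpr h2
  have e : ∀ {u v : α → E} (hu : MemLp u 2 μ) (hv : MemLp v 2 μ),
      ⟪hu.toLp u, hv.toLp v⟫ = ∫ x, ⟪u x, v x⟫ ∂μ := fun hu hv => by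
    rw [L2.inner_def]
    refine integral_congr_ae ?_
    filter_upwards [hu.coeFn_toLp, hv.coeFn_toLp] with x hx hy
    rw [hx, hy]
  have := a1.inner (𝕜 := ℝ) a2
  simpa only [e] using this

theorem tendsto_integral_inner_left {f : ℕ → α → E} {f₀ g : α → E}
    (hf : ∀ k, MemLp (f k) 2 μ) (hf₀ : MemLp f₀ 2 μ) (hg : MemLp g 2 μ)
    (h : Tendsto (fun k => eLpNorm (fun x => f k x - f₀ x) 2 μ) atTop (𝓝 0)) :
    Tendsto (fun k => ∫ x, ⟪f k x, g x⟫ ∂μ) atTop (𝓝 (∫ x, ⟪f₀ x, g x⟫ ∂μ)) :=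
  tendsto_integral_inner hf (fun _ => hg) hf₀ hg h (by simp)

theorem tendsto_integral_mul_left {f : ℕ → α → ℝ} {f₀ g : α → ℝ}
    (hf : ∀ k, MemLp (f k) 2 μ) (hf₀ : MemLp f₀ 2 μ) (hg : MemLp g 2 μ)
    (h : Tendsto (fun k => eLpNorm (fun x => f k x - f₀ x) 2 μ) atTop (𝓝 0)) :
    Tendsto (fun k => ∫ x, f k x * g x ∂μ) atTop (𝓝 (∫ x, f₀ x * g x ∂μ)) := by
  have := tendsto_integral_inner_left hf hf₀ hg h
  simpa [mul_comm] using this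

theorem tendsto_integral_norm_sq {f : ℕ → α → E} {f₀ : α → E}
    (hf : ∀ k, MemLp (f k) 2 μ) (hf₀ : MemLp f₀ 2 μ)
    (h : Tendsto (fun k => eLpNorm (fun x => f k x - f₀ x) 2 μ) atTop (𝓝 0)) :
    Tendsto (fun k => ∫ x, ‖f k x‖ ^ 2 ∂μ) atTop (𝓝 (∫ x, ‖f₀ x‖ ^ 2 ∂μ)) := by
  have := tendsto_integral_inner hf hf hf₀ hf₀ h h
  simpa only [real_inner_self_eq_norm_sq] using this

end L2

theorem memLp_of_continuous {μ : Measure (Sph n)} [IsFiniteMeasure μ] {E : Type*}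
    [NormedAddCommGroup E] {f : Sph n → E} (hf : Continuous f) : MemLp f 2 μ :=
  hf.memLp_of_hasCompactSupport (HasCompactSupport.of_compactSpace f)

/-! ### Cut-off functions near the equator -/

/-- A smooth step: `0` up to `1`, and `1` from `2` on. -/
def step (t : ℝ) : ℝ := Real.smoothTransition (t - 1)

theorem contDiff_step : ContDiff ℝ ∞ step :=
  Real.smoothTransition.contDiff.comp (contDiff_id.sub contDiff_const)

theorem step_nonneg (t : ℝ) : 0 ≤ step t := Real.smoothTransition.nonneg _

theorem step_le_one (t : ℝ) : step t ≤ 1 := Real.smoothTransition.le_one _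

theorem step_eq_zero {t : ℝ} (ht : t ≤ 1) : step t = 0 :=
  Real.smoothTransition.zero_of_nonpos (by linarith)

theorem step_eq_one {t : ℝ} (ht : 2 ≤ t) : step t = 1 :=
  Real.smoothTransition.one_of_one_le (by linarith)

/-- The value is a global minimum, an argument that covers the endpoint `1` too. -/
theorem deriv_step_of_le {t : ℝ} (ht : t ≤ 1) : deriv step t = 0 :=
  IsLocalMin.deriv_eq_zero (.of_forall fun s => by rw [step_eq_zero ht]; exact step_nonneg s)

theorem deriv_step_of_ge {t : ℝ} (ht : 2 ≤ t) : deriv step t = 0 :=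
  IsLocalMax.deriv_eq_zero (.of_forall fun s => by rw [step_eq_one ht]; exact step_le_one s)

theorem exists_deriv_step_bound : ∃ C, ∀ t, deriv step t ^ 2 ≤ C := by
  have hc : Continuous fun t => deriv step t ^ 2 :=
    (contDiff_step.continuous_deriv (by simp)).pow 2
  obtain ⟨C, hC⟩ := (isCompact_Icc (a := (1 : ℝ)) (b := 2)).bddAbove_image hc.continuousOn
  refine ⟨C, fun t => ?_⟩
  by_cases ht : t ∈ Set.Icc (1 : ℝ) 2
  · exact hC (Set.mem_image_of_mem _ ht)
  · have h0 : deriv step t = 0 := by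
      rcases le_or_gt t 1 with h | h
      · exact deriv_step_of_le h
      · exact deriv_step_of_ge (not_lt.mp fun h' => ht ⟨h.le, h'.le⟩)
    have := hC (Set.mem_image_of_mem _ (Set.left_mem_Icc.mpr (by norm_num : (1 : ℝ) ≤ 2)))
    rw [h0, zero_pow two_ne_zero]
    exact (sq_nonneg _).trans this

/-- The dyadic averages of the smooth step. -/
def avg (k : ℕ) (t : ℝ) : ℝ := ((k : ℝ) + 1)⁻¹ * ∑ j ∈ Finset.range (k + 1), step (2 ^ j * t)

/-- Cut-off functions that vanish near the equator and converge to `1`. -/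
def cutoff (n k : ℕ) (σ : Sph n) : ℝ := avg k (height σ)

theorem avg_nonneg (k : ℕ) (t : ℝ) : 0 ≤ avg k t :=
  mul_nonneg (by positivity) (Finset.sum_nonneg fun _ _ => step_nonneg _)

theorem avg_le_one (k : ℕ) (t : ℝ) : avg k t ≤ 1 := by
  rw [avg, inv_mul_le_iff₀ (by positivity), mul_one]
  refine (Finset.sum_le_sum fun j _ => step_le_one (2 ^ j * t)).trans ?_
  simp

theorem tendsto_avg {t : ℝ} (ht : 0 < t) : Tendsto (fun k => avg k t) atTop (𝓝 1) := by
  have h1 : Tendsto (fun j : ℕ => step (2 ^ j * t)) atTop (𝓝 1) := by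
    have : Tendsto (fun j : ℕ => (2 : ℝ) ^ j * t) atTop atTop :=
      (tendsto_pow_atTop_atTop_of_one_lt one_lt_two).atTop_mul_const ht
    refine tendsto_const_nhds.congr' ?_
    filter_upwards [this.eventually_ge_atTop 2] with j hj
    rw [step_eq_one hj]
  have h2 := (tendsto_add_atTop_iff_nat 1).mpr h1.cesaro
  simpa [avg] using h2

theorem contDiff_avg (k : ℕ) : ContDiff ℝ ∞ (avg k) := by
  unfold avg
  exact contDiff_const.mul (ContDiff.sum fun j _ =>
    contDiff_step.comp (contDiff_const.mul contDiff_id))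

theorem hasDerivAt_avg (k : ℕ) (t : ℝ) :
    HasDerivAt (avg k)
      (((k : ℝ) + 1)⁻¹ * ∑ j ∈ Finset.range (k + 1), 2 ^ j * deriv step (2 ^ j * t)) t := by
  refine HasDerivAt.const_mul _ (HasDerivAt.fun_sum fun j _ => ?_)
  have h := (contDiff_step.differentiable (by simp) (2 ^ j * t)).hasDerivAt.comp t
    ((hasDerivAt_id t).const_mul (2 ^ j))
  simpa [mul_comm, Function.comp_def] using h

/-- The derivative of `step` lives on `1 < t < 2`, so at most one of the dyadic dilations
contributes at a given `t` and the cross terms vanish. -/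
theorem sum_deriv_step_sq (k : ℕ) (t : ℝ) :
    (∑ j ∈ Finset.range (k + 1), 2 ^ j * deriv step (2 ^ j * t)) ^ 2
      = ∑ j ∈ Finset.range (k + 1), (2 ^ j * deriv step (2 ^ j * t)) ^ 2 := by
  have key : ∀ i j : ℕ, i < j → deriv step (2 ^ i * t) * deriv step (2 ^ j * t) = 0 := by
    intro i j hij
    rcases le_or_gt (2 ^ i * t) 1 with h | h
    · rw [deriv_step_of_le h, zero_mul]
    · rw [deriv_step_of_ge (t := 2 ^ j * t), mul_zero]
      obtain ⟨m, rfl⟩ := Nat.exists_eq_add_of_lt hij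
      have : (1 : ℝ) ≤ 2 ^ m := one_le_pow₀ (by norm_num)
      rw [show (2 : ℝ) ^ (i + m + 1) * t = 2 * (2 ^ m * (2 ^ i * t)) by ring]
      nlinarith
  rw [sq, Finset.sum_mul_sum]
  refine Finset.sum_congr rfl fun i hi => ?_
  rw [Finset.sum_eq_single_of_mem i hi, sq]
  intro j _ hij
  rcases lt_or_gt_of_ne hij with h | h
  · have := key j i h
    linear_combination (2 : ℝ) ^ i * 2 ^ j * this
  · have := key i j h
    linear_combination (2 : ℝ) ^ i * 2 ^ j * this

theorem isTest_cutoff (n k : ℕ) : IsTest (cutoff n k) := by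
  refine ⟨smooth_iff.mp fun σ => SmoothAt.comp (contDiff_avg k).contDiffAt (smooth_height σ), ?_⟩
  have hc : IsClosed {σ : Sph n | 1 ≤ 2 ^ k * height σ} :=
    isClosed_le continuous_const (continuous_const.mul continuous_height)
  refine (closure_minimal (fun σ hσ => ?_) hc).trans fun σ hσ => ?_
  · by_contra h
    refine hσ ?_
    rw [cutoff, avg, Finset.sum_eq_zero, mul_zero]
    intro j hj
    refine step_eq_zero ?_
    have h1 : 2 ^ k * height σ < 1 := not_le.mp h
    rcases le_or_gt (height σ) 0 with h0 | h0
    · exact (mul_nonpos_of_nonneg_of_nonpos (by positivity) h0).trans zero_le_one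
    · refine le_trans ?_ h1.le
      gcongr
      · norm_num
      · exact Nat.lt_succ_iff.mp (Finset.mem_range.mp hj)
  · have h1 : (1 : ℝ) ≤ 2 ^ k * height σ := hσ
    exact pos_of_mul_pos_right (zero_lt_one.trans_le h1) (by positivity)

theorem norm_sphGrad_cutoff_sq_le (k : ℕ) (σ : Sph n) :
    ‖sphGrad (cutoff n k) σ‖ ^ 2 ≤ (((k : ℝ) + 1)⁻¹) ^ 2 *
      ∑ j ∈ Finset.range (k + 1), (2 ^ j * deriv step (2 ^ j * height σ)) ^ 2 := by
  have h : sphGrad (cutoff n k) σ = _ :=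
    (HasSphGrad.comp (hasDerivAt_avg k (height σ)) (smooth_height σ).hasSphGrad).eq
  rw [h, norm_smul, mul_pow, norm_sphGrad_height_sq, Real.norm_eq_abs, sq_abs, mul_pow,
    sum_deriv_step_sq]
  refine mul_le_of_le_one_right ?_ (by have := sq_nonneg (height σ); linarith)
  exact mul_nonneg (sq_nonneg _) (Finset.sum_nonneg fun _ _ => sq_nonneg _)

-- The surface measure is `N` times the volume of the cone over the set, and this cone lies in the
-- box `[-1, 1]^n × [0, t]`.
open scoped Pointwise in
theorem exists_dS_height_le (n : ℕ) :
    ∃ C : ℝ, 0 ≤ C ∧ ∀ t : ℝ, 0 ≤ t → (dS n).real {σ | height σ ≤ t} ≤ C * t := by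
  refine ⟨(n + 1) * 2 ^ n, by positivity, fun t ht => ?_⟩
  let a : Fin (n + 1) → ℝ := Fin.snoc (fun _ => -1) 0
  let b : Fin (n + 1) → ℝ := Fin.snoc (fun _ => 1) t
  have hm : MeasurableSet {σ : Sph n | height σ ≤ t} :=
    measurableSet_le continuous_height.measurable measurable_const
  have h1 : dS n {σ | height σ ≤ t} ≤ ENNReal.ofReal ((n + 1) * 2 ^ n * t) := by
    rw [dS, Measure.restrict_apply hm, Measure.toSphere_apply' _ (hm.inter measurableSet_upper)]
    have hsub : Set.Ioo (0 : ℝ) 1 • (Subtype.val '' ({σ : Sph n | height σ ≤ t} ∩ upper n))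
        ⊆ (WithLp.ofLp : Amb n → (Fin (n + 1) → ℝ)) ⁻¹' Set.Icc a b := by
      rintro _ ⟨r, ⟨hr0, hr1⟩, _, ⟨σ, ⟨hσt, hσ⟩, rfl⟩, rfl⟩
      have hσt' : height σ ≤ t := hσt
      have hσ' : 0 < height σ := hσ
      have habs : ∀ i, |r * (σ : Amb n) i| ≤ 1 := fun i => by
        rw [abs_mul, abs_of_pos hr0]
        have h := PiLp.norm_apply_le (σ : Amb n) i
        rw [norm_sph, Real.norm_eq_abs] at h
        exact mul_le_one₀ hr1.le (abs_nonneg _) h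
      constructor
      · intro i
        refine Fin.lastCases ?_ (fun i => ?_) i
        · simp only [a, Fin.snoc_last]
          exact mul_nonneg hr0.le hσ'.le
        · simp only [a, Fin.snoc_castSucc]
          exact (abs_le.mp (habs i.castSucc)).1
      · intro i
        refine Fin.lastCases ?_ (fun i => ?_) i
        · simp only [b, Fin.snoc_last]
          exact (mul_le_of_le_one_left hσ'.le hr1.le).trans hσt'
        · simp only [b, Fin.snoc_castSucc]
          exact (abs_le.mp (habs i.castSucc)).2
    have hvol : (volume : Measure (Amb n))
        ((WithLp.ofLp : Amb n → (Fin (n + 1) → ℝ)) ⁻¹' Set.Icc a b)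
          = ENNReal.ofReal (2 ^ n * t) := by
      rw [(PiLp.volume_preserving_ofLp (Fin (n + 1))).measure_preimage
        measurableSet_Icc.nullMeasurableSet, Real.volume_Icc_pi, Fin.prod_univ_castSucc]
      simp only [a, b, Fin.snoc_last, Fin.snoc_castSucc]
      rw [Finset.prod_const, ← ENNReal.ofReal_pow (by norm_num), ← ENNReal.ofReal_mul (by positivity)]
      norm_num
    calc _ ≤ ((n + 1 : ℕ) : ENNReal) * ENNReal.ofReal (2 ^ n * t) := by
          rw [← hvol]
          gcongr
          simp
      _ = _ := by
          rw [← ENNReal.ofReal_natCast, ← ENNReal.ofReal_mul (by positivity)]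
          push_cast
          ring_nf
  rw [Measure.real]
  exact ENNReal.toReal_le_of_le_ofReal (by positivity) h1

theorem rho_sq_le_height (κ : ℝ) {σ : Sph n} (hσ : σ ∈ upper n) : rho κ σ ^ 2 ≤ height σ := by
  rw [rho_sq κ hσ]
  exact (Real.rpow_le_rpow_of_exponent_ge hσ (height_le_one σ) (one_le_alphaPlus κ)).trans
    (Real.rpow_one _).le

/-- The step of index `j` has squared gradient of order `4^j` on a strip of measure `O(2^(-j))`,
where the weight is also `O(2^(-j))`: its energy is bounded uniformly in `j`. Averaging `k + 1`
steps with disjoint gradients divides the sum of the energies by `(k+1)²`, so the total is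
`O(1/(k+1))`. -/
theorem tendsto_integral_sphGrad_cutoff (n : ℕ) (κ : ℝ) :
    Tendsto (fun k => ∫ σ, ‖sphGrad (cutoff n k) σ‖ ^ 2 ∂(weighted n κ)) atTop (𝓝 0) := by
  obtain ⟨C, hC⟩ := exists_deriv_step_bound
  obtain ⟨D, hD0, hD⟩ := exists_dS_height_le n
  have hC0 : 0 ≤ C := (sq_nonneg _).trans (hC 0)
  have hdc : Continuous (deriv step) := contDiff_step.continuous_deriv (by simp)
  have hcj : ∀ j : ℕ, Continuous fun σ : Sph n => (2 ^ j * deriv step (2 ^ j * height σ)) ^ 2 :=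
    fun j => by have := continuous_height (n := n); fun_prop
  have hj : ∀ j : ℕ, ∫ σ : Sph n, (2 ^ j * deriv step (2 ^ j * height σ)) ^ 2 ∂(weighted n κ)
      ≤ 4 * C * D := by
    intro j
    have h2 : (0 : ℝ) < 2 ^ j := by positivity
    let S : Set (Sph n) := {σ | height σ ≤ 2 * (2 ^ j)⁻¹}
    have hS : MeasurableSet S := measurableSet_le continuous_height.measurable measurable_const
    rw [integral_weighted]
    calc ∫ σ : Sph n, rho κ σ ^ 2 * (2 ^ j * deriv step (2 ^ j * height σ)) ^ 2 ∂(dS n)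
        ≤ ∫ σ : Sph n, S.indicator (fun _ => 2 * 2 ^ j * C) σ ∂(dS n) := by
          refine integral_mono_of_nonneg (.of_forall fun σ => by positivity)
            ((integrable_const _).indicator hS) ?_
          filter_upwards [ae_mem_upper] with σ hσ
          by_cases hσS : σ ∈ S
          · rw [Set.indicator_of_mem hσS, mul_pow]
            have h3 : rho κ σ ^ 2 ≤ 2 * (2 ^ j)⁻¹ := (rho_sq_le_height κ hσ).trans hσS
            calc rho κ σ ^ 2 * ((2 ^ j) ^ 2 * deriv step (2 ^ j * height σ) ^ 2)
                ≤ (2 * (2 ^ j)⁻¹) * ((2 ^ j) ^ 2 * C) := by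
                  gcongr
                  exact hC _
              _ = 2 * 2 ^ j * C := by field_simp
          · rw [Set.indicator_of_notMem hσS, deriv_step_of_ge]
            · simp
            · have h3 : 2 * (2 ^ j)⁻¹ < height σ := not_le.mp hσS
              rw [← div_eq_mul_inv, div_lt_iff₀ h2] at h3
              linarith
      _ = (dS n).real S * (2 * 2 ^ j * C) := by
          rw [integral_indicator_const _ hS, smul_eq_mul]
      _ ≤ D * (2 * (2 ^ j)⁻¹) * (2 * 2 ^ j * C) := by
          gcongr
          exact hD _ (by positivity)
      _ = 4 * C * D := by field_simp; ring
  have hk : ∀ k : ℕ, ∫ σ, ‖sphGrad (cutoff n k) σ‖ ^ 2 ∂(weighted n κ)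
      ≤ 4 * C * D * (1 / ((k : ℝ) + 1)) := by
    intro k
    calc ∫ σ, ‖sphGrad (cutoff n k) σ‖ ^ 2 ∂(weighted n κ)
        ≤ ∫ σ : Sph n, (((k : ℝ) + 1)⁻¹) ^ 2 * ∑ j ∈ Finset.range (k + 1),
            (2 ^ j * deriv step (2 ^ j * height σ)) ^ 2 ∂(weighted n κ) :=
          integral_mono
            (integrable_of_continuous ((isTest_cutoff n k).smooth.continuous_sphGrad.norm.pow 2))
            (integrable_of_continuous
              (continuous_const.fun_mul (continuous_finsetSum _ fun j _ => hcj j)))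
            (norm_sphGrad_cutoff_sq_le k)
      _ = (((k : ℝ) + 1)⁻¹) ^ 2 * ∑ j ∈ Finset.range (k + 1),
            ∫ σ : Sph n, (2 ^ j * deriv step (2 ^ j * height σ)) ^ 2 ∂(weighted n κ) := by
          rw [integral_const_mul, integral_finsetSum _ fun j _ => integrable_of_continuous (hcj j)]
      _ ≤ (((k : ℝ) + 1)⁻¹) ^ 2 * ∑ j ∈ Finset.range (k + 1), 4 * C * D := by
          gcongr with j
          exact hj j
      _ = 4 * C * D * (1 / ((k : ℝ) + 1)) := by
          rw [Finset.sum_const, Finset.card_range, nsmul_eq_mul]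
          push_cast
          field_simp
  refine squeeze_zero (fun k => integral_nonneg fun σ => sq_nonneg _) hk ?_
  simpa using (tendsto_one_div_add_atTop_nhds_zero_nat (𝕜 := ℝ)).const_mul (4 * C * D)

theorem tendsto_integral_cutoff_sub_one (κ : ℝ) {E : Type*} [NormedAddCommGroup E]
    [NormedSpace ℝ E] {f : Sph n → E} (hf : Continuous f) :
    Tendsto (fun k => ∫ σ, ‖(cutoff n k σ - 1) • f σ‖ ^ 2 ∂(weighted n κ)) atTop (𝓝 0) := by
  have h0 : ∫ _ : Sph n, (0 : ℝ) ∂(weighted n κ) = 0 := by simp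
  rw [← h0]
  refine tendsto_integral_of_dominated_convergence (fun σ => ‖f σ‖ ^ 2) (fun k => ?_)
    (integrable_of_continuous (hf.norm.pow 2)) (fun k => .of_forall fun σ => ?_) ?_
  · exact ((((isTest_cutoff n k).continuous.fun_sub continuous_const).smul hf).norm.pow
      2).aestronglyMeasurable
  · rw [norm_smul, mul_pow, norm_mul, norm_pow, norm_pow, norm_norm, norm_norm]
    refine mul_le_of_le_one_left (sq_nonneg _) (pow_le_one₀ (norm_nonneg _) ?_)
    rw [Real.norm_eq_abs, abs_le]
    have h1 := avg_nonneg k (height σ)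
    have h2 := avg_le_one k (height σ)
    constructor <;> simp only [cutoff] <;> linarith
  · filter_upwards [ae_weighted_mem_upper κ] with σ hσ
    have := ((((tendsto_avg hσ).sub_const 1).smul_const (f σ)).norm).pow 2
    simpa [cutoff] using this

/-- Smooth functions on the sphere belong to the weighted space `H^1_0`. -/
theorem Smooth.hasH10Grad (κ : ℝ) {q : Sph n → ℝ} (hq : Smooth q) :
    HasH10Grad (weighted n κ) q (sphGrad q) ∧
    Tendsto (fun k => eLpNorm (fun σ => q σ * cutoff n k σ - q σ) 2 (weighted n κ)) atTop (𝓝 0) ∧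
    Tendsto (fun k => eLpNorm (fun σ => sphGrad (fun σ => q σ * cutoff n k σ) σ - sphGrad q σ) 2
      (weighted n κ)) atTop (𝓝 0) := by
  have ht : ∀ k, IsTest (fun σ => q σ * cutoff n k σ) := fun k =>
    (isTest_cutoff n k).smooth_mul hq
  have h1 : Tendsto (fun k => eLpNorm (fun σ => q σ * cutoff n k σ - q σ) 2 (weighted n κ))
      atTop (𝓝 0) := by
    refine tendsto_eLpNorm_two_zero (fun k => memLp_of_continuous
      ((ht k).continuous.sub hq.continuous)) ?_
    refine (tendsto_integral_cutoff_sub_one κ hq.continuous).congr fun k => ?_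
    congr 1
    ext σ
    rw [smul_eq_mul, sub_mul, one_mul, mul_comm]
  have h2 : Tendsto (fun k => eLpNorm (fun σ => sphGrad (fun σ => q σ * cutoff n k σ) σ
      - sphGrad q σ) 2 (weighted n κ)) atTop (𝓝 0) := by
    refine tendsto_eLpNorm_two_zero (fun k => memLp_of_continuous
      ((ht k).smooth.continuous_sphGrad.sub hq.continuous_sphGrad)) ?_
    obtain ⟨M, hM⟩ := isCompact_univ.bddAbove_image (hq.continuous.pow 2).continuousOn
    have hM' : ∀ σ, q σ ^ 2 ≤ M := fun σ => hM (Set.mem_image_of_mem _ (Set.mem_univ σ))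
    have hlim := ((tendsto_integral_cutoff_sub_one κ hq.continuous_sphGrad).const_mul 2).add
      ((tendsto_integral_sphGrad_cutoff n κ).const_mul (2 * M))
    rw [mul_zero, mul_zero, add_zero] at hlim
    refine squeeze_zero (fun k => integral_nonneg fun σ => sq_nonneg _) (fun k => ?_) hlim
    have hc1 : Continuous fun σ => ‖(cutoff n k σ - 1) • sphGrad q σ‖ ^ 2 :=
      (((isTest_cutoff n k).continuous.fun_sub continuous_const).smul
        hq.continuous_sphGrad).norm.pow 2
    have hc2 : Continuous fun σ => ‖sphGrad (cutoff n k) σ‖ ^ 2 :=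
      (isTest_cutoff n k).smooth.continuous_sphGrad.norm.pow 2
    rw [← integral_const_mul, ← integral_const_mul,
      ← integral_add (integrable_of_continuous (continuous_const.fun_mul hc1))
        (integrable_of_continuous (continuous_const.fun_mul hc2))]
    refine integral_mono (integrable_of_continuous
      (((ht k).smooth.continuous_sphGrad.sub hq.continuous_sphGrad).norm.pow 2))
      (integrable_of_continuous ((continuous_const.fun_mul hc1).add
        (continuous_const.fun_mul hc2))) fun σ => ?_
    -- The two pieces tend to zero by dominated convergence and by the vanishing energy of the
    -- cut-offs; they are separated by `‖u + v‖² ≤ 2‖u‖² + 2‖v‖²`.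
    have e : sphGrad (fun σ => q σ * cutoff n k σ) σ - sphGrad q σ
        = (cutoff n k σ - 1) • sphGrad q σ + q σ • sphGrad (cutoff n k) σ := by
      rw [sphGrad_mul (hq σ) ((isTest_cutoff n k).smooth σ)]
      module
    have e2 : ‖q σ • sphGrad (cutoff n k) σ‖ ^ 2 ≤ M * ‖sphGrad (cutoff n k) σ‖ ^ 2 := by
      rw [norm_smul, mul_pow, Real.norm_eq_abs, sq_abs]
      exact mul_le_mul_of_nonneg_right (hM' σ) (sq_nonneg _)
    simp only [e]
    have h3 := norm_add_le ((cutoff n k σ - 1) • sphGrad q σ) (q σ • sphGrad (cutoff n k) σ)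
    have h4 := norm_nonneg ((cutoff n k σ - 1) • sphGrad q σ + q σ • sphGrad (cutoff n k) σ)
    nlinarith [sq_nonneg (‖(cutoff n k σ - 1) • sphGrad q σ‖ - ‖q σ • sphGrad (cutoff n k) σ‖)]
  exact ⟨⟨memLp_of_continuous hq.continuous, memLp_of_continuous hq.continuous_sphGrad, _, ht,
    h1, h2⟩, h1, h2⟩

/-! ### The weak form of the eigenvalue equation -/

theorem IsTest.memLp {μ : Measure (Sph n)} [IsFiniteMeasure μ] {f : Sph n → ℝ} (hf : IsTest f) :
    MemLp f 2 μ := memLp_of_continuous hf.continuous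

theorem IsTest.memLp_sphGrad {μ : Measure (Sph n)} [IsFiniteMeasure μ] {f : Sph n → ℝ}
    (hf : IsTest f) : MemLp (sphGrad f) 2 μ := memLp_of_continuous hf.smooth.continuous_sphGrad

theorem integral_mul_sphLap (hn : 1 ≤ n) {f g : Sph n → ℝ} (hf : IsTest f) (hg : IsTest g) :
    ∫ σ, f σ * sphLap g σ ∂(dS n) = -∫ σ, ⟪sphGrad f σ, sphGrad g σ⟫ ∂(dS n) := by
  rw [integral_dS_eq_surf fun σ hσ => by rw [hf.zero_of_notMem hσ, zero_mul],
    integral_dS_eq_surf fun σ hσ => by rw [hf.sphGrad_zero hσ, inner_zero_left],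
    integral_mul_sphLap_surf hn hf.smooth hg.smooth]

/-- The spherical Hardy operator. -/
def hardyOp (κ : ℝ) (ζ : Sph n → ℝ) (σ : Sph n) : ℝ :=
  -sphLap ζ σ - κ * (height σ ^ 2)⁻¹ * ζ σ

theorem IsTest.hardyOp {ζ : Sph n → ℝ} (hζ : IsTest ζ) (κ : ℝ) : IsTest (hardyOp κ ζ) := by
  have h1 := (hζ.rpow_mul (-2)).const_mul (-κ)
  have h2 := hζ.sphLap.const_mul (-1)
  have e : HardySphere.hardyOp κ ζ
      = fun σ => -1 * HardySphere.sphLap ζ σ + -κ * (height σ ^ (-2 : ℝ) * ζ σ) := by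
    ext σ
    rw [HardySphere.hardyOp]
    by_cases hσ : σ ∈ upper n
    · rw [Real.rpow_neg (le_of_lt hσ), Real.rpow_two]; ring
    · simp [hζ.zero_of_notMem hσ]
  rw [e]
  exact h2.add h1

theorem integral_rho_mul_hardyOp (hn : 1 ≤ n) {κ : ℝ} (hκ : κ ≤ 1 / 4) {φ η : Sph n → ℝ}
    (hφ : IsTest φ) (hη : IsTest η) :
    ∫ σ, rho κ σ * φ σ * hardyOp κ (fun σ => rho κ σ * η σ) σ ∂(dS n)
      = (∫ σ, ⟪sphGrad φ σ, sphGrad η σ⟫ ∂(weighted n κ))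
        + mu1 (n + 1) κ * ∫ σ, φ σ * η σ ∂(weighted n κ) := by
  have hF := hφ.rho_mul κ
  have hH := hη.rho_mul κ
  have h1 := integral_ground_state hn hκ hφ hη
  rw [integral_sub (hF.inner_sphGrad hH.smooth).integrable (hF.hardy hH κ).integrable,
    integral_add (hφ.inner_sphGrad hη.smooth).integrable
      ((hη.smooth_mul hφ.smooth).const_mul _).integrable, integral_const_mul] at h1
  rw [← h1, eq_sub_iff_add_eq, ← integral_add ((hH.hardyOp κ).smooth_mul hF.smooth).integrable
    (hF.hardy hH κ).integrable, ← neg_eq_iff_eq_neg.mpr (integral_mul_sphLap hn hF hH),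
    ← integral_neg]
  refine integral_congr_ae (.of_forall fun σ => ?_)
  simp only [hardyOp]
  ring

theorem integral_mul_rho_eq_weighted (κ : ℝ) (ψ s : Sph n → ℝ) :
    ∫ σ, ψ σ / rho κ σ * (height σ ^ (-(alphaPlus κ / 2)) * s σ) ∂(weighted n κ)
      = ∫ σ, ψ σ * s σ ∂(dS n) := by
  rw [integral_weighted]
  refine integral_congr_ae ?_
  filter_upwards [ae_mem_upper] with σ hσ
  have h := rho_pos κ hσ
  have e : height σ ^ (-(alphaPlus κ / 2)) = (rho κ σ)⁻¹ := Real.rpow_neg (le_of_lt hσ) _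
  rw [e]
  field_simp

theorem integral_mul_rho_eq_weighted' (κ : ℝ) (ψ η : Sph n → ℝ) :
    ∫ σ, ψ σ / rho κ σ * η σ ∂(weighted n κ) = ∫ σ, ψ σ * (rho κ σ * η σ) ∂(dS n) := by
  rw [integral_weighted]
  refine integral_congr_ae ?_
  filter_upwards [ae_mem_upper] with σ hσ
  have h := rho_pos κ hσ
  field_simp

/-- The identity for test functions passes to the limit: the operator falls on a test function, so
the weighted `L²` convergence of `φ k` and of its gradients suffices. -/
theorem integral_mul_hardyOp (hn : 1 ≤ n) {κ : ℝ} (hκ : κ ≤ 1 / 4) {ψ η : Sph n → ℝ}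
    {G : Sph n → Amb n} (hψ : HasH10Grad (weighted n κ) (fun σ => ψ σ / rho κ σ) G)
    (hη : IsTest η) :
    ∫ σ, ψ σ * hardyOp κ (fun σ => rho κ σ * η σ) σ ∂(dS n)
      = (∫ σ, ⟪G σ, sphGrad η σ⟫ ∂(weighted n κ))
        + mu1 (n + 1) κ * ∫ σ, ψ σ / rho κ σ * η σ ∂(weighted n κ) := by
  obtain ⟨hw, hG, φ, hφ, h1, h2⟩ := hψ
  set s := hardyOp κ (fun σ => rho κ σ * η σ) with hs
  -- Dividing by `ρ` keeps the class of test functions, whose supports avoid the equator; `∫ ψ s dS`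
  -- is thus a weighted pairing of `ψ/ρ` with a test function.
  have hst : IsTest (fun σ => height σ ^ (-(alphaPlus κ / 2)) * s σ) :=
    ((hη.rho_mul κ).hardyOp κ).rpow_mul _
  have l1 := tendsto_integral_mul_left (fun k => (hφ k).memLp) hw hst.memLp h1
  have l2 := tendsto_integral_inner_left (fun k => (hφ k).memLp_sphGrad) hG hη.memLp_sphGrad h2
  have l3 := (tendsto_integral_mul_left (fun k => (hφ k).memLp) hw hη.memLp h1).const_mul
    (mu1 (n + 1) κ)
  rw [integral_mul_rho_eq_weighted] at l1
  refine tendsto_nhds_unique l1 ((l2.add l3).congr fun k => ?_)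
  rw [← integral_rho_mul_hardyOp hn hκ (hφ k) hη, ← hs,
    ← integral_mul_rho_eq_weighted κ (fun σ => rho κ σ * φ k σ)]
  refine integral_congr_ae ?_
  filter_upwards [ae_weighted_mem_upper κ] with σ hσ
  have h := rho_pos κ hσ
  field_simp

/-- `w` is a weak solution, with gradient `G`, of the weighted eigenvalue equation. -/
structure IsWeak (κ ev : ℝ) (w : Sph n → ℝ) (G : Sph n → Amb n) : Prop where
  hasH10Grad : HasH10Grad (weighted n κ) w G
  eq_test : ∀ η, IsTest η → ∫ σ, ⟪G σ, sphGrad η σ⟫ ∂(weighted n κ)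
    = ev * ∫ σ, w σ * η σ ∂(weighted n κ)

theorem IsEigenfunction.exists_isWeak (hn : 1 ≤ n) {κ ev : ℝ} (hκ : κ ≤ 1 / 4) {ψ : Sph n → ℝ}
    (hψ : IsEigenfunction κ ev ψ) :
    ∃ G, IsWeak κ (ev - mu1 (n + 1) κ) (fun σ => ψ σ / rho κ σ) G := by
  obtain ⟨⟨G, hG⟩, -, h⟩ := hψ
  refine ⟨G, hG, fun η hη => ?_⟩
  have h1 := integral_mul_hardyOp hn hκ hG hη
  have h2 := h _ (hη.rho_mul κ)
  rw [← integral_mul_rho_eq_weighted'] at h2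
  have h3 := h1.symm.trans h2
  linarith

theorem IsWeak.isEigenfunction (hn : 1 ≤ n) {κ ev : ℝ} (hκ : κ ≤ 1 / 4) {ψ : Sph n → ℝ}
    {G : Sph n → Amb n} (h : IsWeak κ (ev - mu1 (n + 1) κ) (fun σ => ψ σ / rho κ σ) G)
    (h0 : ¬ ψ =ᵐ[dS n] 0) : IsEigenfunction κ ev ψ := by
  refine ⟨⟨G, h.hasH10Grad⟩, h0, fun ζ hζ => ?_⟩
  -- Every test function is `ρ η` with `η` a test function, so the weak and the distributional
  -- equations are equivalent.
  have hη : IsTest (fun σ => height σ ^ (-(alphaPlus κ / 2)) * ζ σ) := hζ.rpow_mul _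
  have e : ζ = fun σ => rho κ σ * (height σ ^ (-(alphaPlus κ / 2)) * ζ σ) := by
    ext σ
    by_cases hσ : σ ∈ upper n
    · have := rho_pos κ hσ
      have e : height σ ^ (-(alphaPlus κ / 2)) = (rho κ σ)⁻¹ := Real.rpow_neg (le_of_lt hσ) _
      rw [e]; field_simp
    · simp [hζ.zero_of_notMem hσ]
  have h1 := integral_mul_hardyOp hn hκ h.hasH10Grad hη
  rw [h.eq_test _ hη, ← e, integral_mul_rho_eq_weighted] at h1
  refine h1.trans ?_
  ring

theorem HasH10Grad.congr {μ : Measure (Sph n)} {w w' : Sph n → ℝ} {G : Sph n → Amb n}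
    (h : HasH10Grad μ w G) (hw : w =ᵐ[μ] w') : HasH10Grad μ w' G := by
  obtain ⟨h1, h2, φ, h3, h4, h5⟩ := h
  refine ⟨(memLp_congr_ae hw).mp h1, h2, φ, h3, h4.congr fun k => eLpNorm_congr_ae ?_, h5⟩
  filter_upwards [hw] with σ hσ
  rw [hσ]

theorem IsWeak.congr {κ ev : ℝ} {w w' : Sph n → ℝ} {G : Sph n → Amb n}
    (h : IsWeak κ ev w G) (hw : w =ᵐ[weighted n κ] w') : IsWeak κ ev w' G := by
  refine ⟨h.hasH10Grad.congr hw, fun η hη => ?_⟩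
  rw [h.eq_test η hη]
  congr 1
  refine integral_congr_ae ?_
  filter_upwards [hw] with σ hσ
  rw [hσ]

theorem IsWeak.eq_smooth {κ ev : ℝ} {w : Sph n → ℝ} {G : Sph n → Amb n} (h : IsWeak κ ev w G)
    {q : Sph n → ℝ} (hq : Smooth q) : ∫ σ, ⟪G σ, sphGrad q σ⟫ ∂(weighted n κ)
      = ev * ∫ σ, w σ * q σ ∂(weighted n κ) := by
  obtain ⟨-, h1, h2⟩ := hq.hasH10Grad κ
  have ht : ∀ k, IsTest (fun σ => q σ * cutoff n k σ) := fun k =>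
    (isTest_cutoff n k).smooth_mul hq
  have l1 := tendsto_integral_inner_left (fun k => (ht k).memLp_sphGrad)
    (memLp_of_continuous hq.continuous_sphGrad) h.hasH10Grad.2.1 h2
  have l2 := (tendsto_integral_mul_left (fun k => (ht k).memLp)
    (memLp_of_continuous hq.continuous) h.hasH10Grad.1 h1).const_mul ev
  have := tendsto_nhds_unique l1 (l2.congr fun k => ?_)
  · simpa only [real_inner_comm, mul_comm (w _)] using this
  · have := h.eq_test _ (ht k)
    simpa only [real_inner_comm, mul_comm (w _)] using this.symm

theorem integral_weighted_inner_sphGrad (hn : 1 ≤ n) (κ : ℝ) {q : Sph n → ℝ} (hq : Smooth q)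
    {y : Amb n} (hy : y (Fin.last n) = 0) : ∫ σ, ⟪sphGrad q σ, y⟫ ∂(weighted n κ)
      = (n + alphaPlus κ) * ∫ σ, q σ * lin y σ ∂(weighted n κ) := by
  obtain ⟨-, h1, h2⟩ := hq.hasH10Grad κ
  have ht : ∀ k, IsTest (fun σ => q σ * cutoff n k σ) := fun k =>
    (isTest_cutoff n k).smooth_mul hq
  have l1 := tendsto_integral_inner_left (fun k => (ht k).memLp_sphGrad)
    (memLp_of_continuous hq.continuous_sphGrad) (memLp_const y) h2
  have l2 := (tendsto_integral_mul_left (fun k => (ht k).memLp)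
    (memLp_of_continuous hq.continuous) (memLp_of_continuous (continuous_lin y)) h1).const_mul
    (n + alphaPlus κ)
  exact tendsto_nhds_unique l1 (l2.congr fun k =>
    (integral_weighted_partialSph hn κ (ht k) hy).symm)

/-- Second moments of the weighted measure. -/
theorem integral_lin_mul_lin (hn : 1 ≤ n) (κ : ℝ) {y : Amb n} (hy : y (Fin.last n) = 0)
    (z : Amb n) : (n + alphaPlus κ + 1) * ∫ σ, lin z σ * lin y σ ∂(weighted n κ)
      = ⟪z, y⟫ * (weighted n κ).real Set.univ := by
  have h := integral_weighted_inner_sphGrad hn κ (smooth_lin z) hy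
  have e : ∀ σ : Sph n, ⟪sphGrad (lin z) σ, y⟫ = ⟪z, y⟫ - lin z σ * lin y σ := fun σ => by
    rw [sphGrad_lin, inner_sub_left, inner_smul_left]
    simp only [lin, conj_trivial, real_inner_comm y]
  simp only [e] at h
  rw [integral_sub (integrable_const _) (integrable_of_continuous
    ((continuous_lin z).fun_mul (continuous_lin y))), integral_const, smul_eq_mul] at h
  linarith

/-- The equation is tested with a power of a linear form, then the gradient is moved off `w`.
Approximation of `w` by test functions shows that no boundary term arises at the equator. -/
theorem IsWeak.integral_powLap (hn : 1 ≤ n) {κ ev : ℝ} {w : Sph n → ℝ} {G : Sph n → Amb n}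
    (h : IsWeak κ ev w G) {y : Amb n} (hy : y (Fin.last n) = 0) (m : ℕ) :
    ∫ σ, w σ * powLap κ y m σ ∂(weighted n κ)
      = ev * ∫ σ, w σ * lin y σ ^ (m + 1) ∂(weighted n κ) := by
  rw [← h.eq_smooth ((smooth_lin y).pow (m + 1))]
  obtain ⟨hw, hG, φ, hφ, h1, h2⟩ := h.hasH10Grad
  have l1 := tendsto_integral_mul_left (fun k => (hφ k).memLp) hw
    (memLp_of_continuous (continuous_powLap κ y m)) h1
  have l2 := tendsto_integral_inner_left (fun k => (hφ k).memLp_sphGrad) hG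
    (memLp_of_continuous ((smooth_lin y).pow (m + 1)).continuous_sphGrad) h2
  exact tendsto_nhds_unique l1 (l2.congr fun k =>
    integral_inner_sphGrad_lin_pow hn κ (hφ k) hy m)

theorem IsWeak.ev_mul_integral {κ ev : ℝ} {w : Sph n → ℝ} {G : Sph n → Amb n}
    (h : IsWeak κ ev w G) : ev * ∫ σ, w σ ∂(weighted n κ) = 0 := by
  have := h.eq_smooth (smoothAt_const 1)
  simpa [(hasSphGrad_const (1 : ℝ) _).eq] using this.symm

theorem isWeak_const (κ c : ℝ) : IsWeak (n := n) κ 0 (fun _ => c) 0 := by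
  have h := (Smooth.hasH10Grad κ (smoothAt_const (n := n) c)).1
  have e : sphGrad (fun _ : Sph n => c) = 0 := funext fun σ => (hasSphGrad_const c σ).eq
  rw [e] at h
  exact ⟨h, fun η _ => by simp⟩

theorem isWeak_lin (hn : 1 ≤ n) (κ : ℝ) {y : Amb n} (hy : y (Fin.last n) = 0) :
    IsWeak κ (n + alphaPlus κ) (lin y) (sphGrad (lin y)) := by
  refine ⟨((smooth_lin y).hasH10Grad κ).1, fun η hη => ?_⟩
  simp only [real_inner_comm (sphGrad η _), mul_comm (lin y _)]
  rw [← integral_weighted_partialSph hn κ hη hy]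
  simp only [inner_sphGrad_sphGrad_lin]

/-! ### Moments determine functions on the half-sphere -/

/-- Termwise integration of the exponential series, dominated by `|w| exp ‖y‖` since linear forms
are bounded on the sphere. -/
theorem integral_mul_cexp_eq_zero {μ : Measure (Sph n)} {w : Sph n → ℝ}
    (hw : Integrable w μ) {y : Amb n} (h : ∀ d : ℕ, ∫ σ, w σ * lin y σ ^ d ∂μ = 0) :
    ∫ σ, (w σ : ℂ) * Complex.exp (lin y σ * Complex.I) ∂μ = 0 := by
  let F : ℕ → Sph n → ℂ := fun d σ => (w σ : ℂ) * ((lin y σ * Complex.I) ^ d / d.factorial)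
  have hlc := continuous_lin y
  have hle : ∀ σ : Sph n, |lin y σ| ≤ ‖y‖ := fun σ => by
    simpa [norm_sph, lin] using abs_real_inner_le_norm y (σ : Amb n)
  have hFn : ∀ d σ, ‖F d σ‖ ≤ ‖w σ‖ * (‖y‖ ^ d / d.factorial) := fun d σ => by
    simp only [F, norm_mul, Complex.norm_real, norm_div, norm_pow, Complex.norm_I, mul_one,
      Complex.norm_natCast]
    gcongr
    exact hle σ
  have hFi : ∀ d, Integrable (F d) μ := fun d => by
    refine (hw.norm.mul_const (‖y‖ ^ d / d.factorial)).mono' ?_ (.of_forall (hFn d))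
    refine AEStronglyMeasurable.mul
      (Complex.continuous_ofReal.comp_aestronglyMeasurable hw.1) ?_
    exact Continuous.aestronglyMeasurable (by fun_prop)
  have hs : Summable fun d => ∫ σ, ‖F d σ‖ ∂μ := by
    refine Summable.of_nonneg_of_le (fun d => integral_nonneg fun σ => norm_nonneg _) (fun d => ?_)
      ((Real.summable_pow_div_factorial ‖y‖).mul_left (∫ σ, ‖w σ‖ ∂μ))
    rw [← integral_mul_const]
    exact integral_mono (hFi d).norm (hw.norm.mul_const _) (hFn d)
  have hsum := hasSum_integral_of_summable_integral_norm hFi hs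
  have h0 : ∀ d, ∫ σ, F d σ ∂μ = 0 := fun d => by
    have e : ∀ σ, F d σ = ((w σ * lin y σ ^ d : ℝ) : ℂ) * (Complex.I ^ d / d.factorial) :=
      fun σ => by simp only [F]; push_cast; ring
    simp only [e]
    rw [integral_mul_const, integral_complex_ofReal, h d, Complex.ofReal_zero, zero_mul]
  have e : ∀ σ, ∑' d, F d σ = (w σ : ℂ) * Complex.exp (lin y σ * Complex.I) := fun σ => by
    simp only [F]
    rw [tsum_mul_left, Complex.exp_eq_exp_ℂ, NormedSpace.exp_eq_tsum_div]
  simp only [h0, e] at hsum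
  exact hsum.unique hasSum_zero

/-- The orthogonal projection of the sphere to the hyperplane `x_N = 0`. -/
def flat (σ : Sph n) : Amb n := (σ : Amb n) - height σ • eN n

theorem continuous_flat : Continuous (flat (n := n)) :=
  continuous_subtype_val.sub (continuous_height.smul continuous_const)

theorem flat_inv {σ : Sph n} (hσ : σ ∈ upper n) :
    flat σ + Real.sqrt (1 - ‖flat σ‖ ^ 2) • eN n = (σ : Amb n) := by
  have h : ‖flat σ‖ ^ 2 = 1 - height σ ^ 2 := by
    rw [← real_inner_self_eq_norm_sq, flat, inner_sub_left, inner_sub_right, inner_sub_right,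
      inner_smul_left, inner_smul_right, inner_smul_left, inner_smul_right, inner_eN, inner_eN,
      real_inner_comm (eN n), inner_eN, real_inner_self_eq_norm_sq, norm_sph]
    simp [height]
    ring
  rw [h, sub_sub_cancel, Real.sqrt_sq (le_of_lt hσ), flat, sub_add_cancel]

theorem inner_flat (σ : Sph n) (y : Amb n) :
    ⟪flat σ, y⟫ = lin (y - y (Fin.last n) • eN n) σ := by
  rw [flat, lin, inner_sub_left, inner_sub_left, inner_smul_left, inner_smul_left, inner_eN,
    inner_eN, real_inner_comm]
  simp [height]
  ring

theorem ae_eq_zero_of_moments_of_measurable {μ : Measure (Sph n)} [IsFiniteMeasure μ]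
    (hμ : ∀ᵐ σ ∂μ, σ ∈ upper n) {w : Sph n → ℝ} (hwm : Measurable w) (hw : Integrable w μ)
    (h : ∀ y : Amb n, y (Fin.last n) = 0 → ∀ d : ℕ, ∫ σ, w σ * lin y σ ^ d ∂μ = 0) :
    w =ᵐ[μ] 0 := by
  -- `P` and `Q` have the positive and negative parts of `w` as densities. Equal characteristic
  -- functions make their flat projections equal; undoing the projection by `s`, which is possible
  -- on the upper half-sphere, gives `P = Q`.
  let P : Measure (Sph n) := μ.withDensity fun σ => ENNReal.ofReal (w σ)
  let Q : Measure (Sph n) := μ.withDensity fun σ => ENNReal.ofReal (-w σ)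
  have hfinP : ∫⁻ σ, ENNReal.ofReal (w σ) ∂μ ≠ ⊤ := hw.lintegral_lt_top.ne
  have hfinQ : ∫⁻ σ, ENNReal.ofReal (-w σ) ∂μ ≠ ⊤ := hw.neg.lintegral_lt_top.ne
  have : IsFiniteMeasure P := isFiniteMeasure_withDensity hfinP
  have : IsFiniteMeasure Q := isFiniteMeasure_withDensity hfinQ
  have hwn : Measurable fun σ => ENNReal.ofReal (-w σ) := hwm.neg.ennreal_ofReal
  have hfm : Measurable (flat (n := n)) := continuous_flat.measurable
  have hPQ : P.map flat = Q.map flat := by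
    refine Measure.ext_of_charFun (funext fun t => ?_)
    rw [charFun_apply, charFun_apply, integral_map hfm.aemeasurable
      (Continuous.aestronglyMeasurable (by fun_prop)), integral_map hfm.aemeasurable
      (Continuous.aestronglyMeasurable (by fun_prop)),
      integral_withDensity_eq_integral_toReal_smul hwm.ennreal_ofReal (by simp),
      integral_withDensity_eq_integral_toReal_smul hwn (by simp), ← sub_eq_zero,
      ← integral_sub]
    · rw [← integral_mul_cexp_eq_zero hw (h (t - t (Fin.last n) • eN n) (by simp))]
      refine integral_congr_ae (.of_forall fun σ => ?_)
      simp only [inner_flat]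
      rw [← sub_smul, ENNReal.toReal_ofReal', ENNReal.toReal_ofReal', Complex.real_smul]
      congr 2
      rcases le_total 0 (w σ) with h | h
      · rw [max_eq_left h, max_eq_right (by linarith)]; ring
      · rw [max_eq_right h, max_eq_left (by linarith)]; ring
    all_goals
      refine hw.norm.mono' ?_ (.of_forall fun σ => ?_)
      · have he : Measurable fun σ : Sph n => Complex.exp (⟪flat σ, t⟫ * Complex.I) :=
          Continuous.measurable (by have := continuous_flat (n := n); fun_prop)
        first
        | exact (hwm.ennreal_ofReal.ennreal_toReal.smul he).aestronglyMeasurable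
        | exact (hwn.ennreal_toReal.smul he).aestronglyMeasurable
      · rw [norm_smul, Complex.norm_exp_ofReal_mul_I, mul_one, ENNReal.toReal_ofReal',
          Real.norm_eq_abs, Real.norm_eq_abs, abs_of_nonneg (le_max_right _ _)]
        exact max_le (by first | exact le_abs_self _ | exact neg_le_abs _) (abs_nonneg _)
  let s : Amb n → Amb n := fun x => x + Real.sqrt (1 - ‖x‖ ^ 2) • eN n
  have hs : Measurable s := Continuous.measurable (by fun_prop)
  have hcoe : ∀ R : Measure (Sph n), R ≪ μ → (R.map flat).map s = R.map Subtype.val := by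
    intro R hR
    rw [Measure.map_map hs hfm]
    refine Measure.map_congr ?_
    filter_upwards [hR.ae_le hμ] with σ hσ using flat_inv hσ
  have hval : P.map Subtype.val = Q.map Subtype.val := by
    rw [← hcoe P (withDensity_absolutelyContinuous _ _), ←
      hcoe Q (withDensity_absolutelyContinuous _ _), hPQ]
  have hemb : MeasurableEmbedding (Subtype.val : Sph n → Amb n) :=
    MeasurableEmbedding.subtype_coe Metric.isClosed_sphere.measurableSet
  have hEq : P = Q := by
    rw [← hemb.comap_map P, ← hemb.comap_map Q, hval]
  have hae := (withDensity_eq_iff hwm.ennreal_ofReal.aemeasurable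
    hwn.aemeasurable hfinP).mp hEq
  filter_upwards [hae] with σ hσ
  rcases le_total 0 (w σ) with h | h
  · rw [ENNReal.ofReal_of_nonpos (by linarith : -w σ ≤ 0), ENNReal.ofReal_eq_zero] at hσ
    exact le_antisymm hσ h
  · rw [ENNReal.ofReal_of_nonpos h, eq_comm, ENNReal.ofReal_eq_zero] at hσ
    exact le_antisymm h (by simpa using hσ)

theorem ae_eq_zero_of_moments {μ : Measure (Sph n)} [IsFiniteMeasure μ]
    (hμ : ∀ᵐ σ ∂μ, σ ∈ upper n) {w : Sph n → ℝ} (hw : Integrable w μ)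
    (h : ∀ y : Amb n, y (Fin.last n) = 0 → ∀ d : ℕ, ∫ σ, w σ * lin y σ ^ d ∂μ = 0) :
    w =ᵐ[μ] 0 := by
  have e := hw.1.ae_eq_mk
  refine e.trans (ae_eq_zero_of_moments_of_measurable hμ
    hw.1.stronglyMeasurable_mk.measurable (hw.congr e) fun y hy d => ?_)
  rw [← h y hy d]
  refine integral_congr_ae ?_
  filter_upwards [e] with σ hσ
  rw [hσ]

/-! ### The lower part of the spectrum -/

/-- Orthogonality relations, against powers of linear forms, that weak solutions satisfy. -/
def MomentRel (κ ev : ℝ) (w : Sph n → ℝ) : Prop :=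
  ∀ y : Amb n, y (Fin.last n) = 0 → ∀ m : ℕ, ∫ σ, w σ * powLap κ y m σ ∂(weighted n κ)
    = ev * ∫ σ, w σ * lin y σ ^ (m + 1) ∂(weighted n κ)

theorem integrable_mul_continuous {μ : Measure (Sph n)} [IsFiniteMeasure μ] {w q : Sph n → ℝ}
    (hw : Integrable w μ) (hq : Continuous q) : Integrable (fun σ => w σ * q σ) μ := by
  obtain ⟨C, hC⟩ := isCompact_univ.exists_bound_of_continuousOn hq.continuousOn
  exact hw.mul_bdd (c := C) hq.aestronglyMeasurable (.of_forall fun σ => hC σ (Set.mem_univ σ))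

/-- Linearity of the moment relations lets the expected solution be subtracted without combining
`H^1_0` approximations. -/
theorem MomentRel.sub {κ ev : ℝ} {w v : Sph n → ℝ} (hw : MomentRel κ ev w) (hv : MomentRel κ ev v)
    (hwi : Integrable w (weighted n κ)) (hvi : Integrable v (weighted n κ)) :
    MomentRel κ ev (fun σ => w σ - v σ) := by
  intro y hy m
  have hp : Continuous (powLap κ y m) := continuous_powLap κ y m
  have hl : Continuous fun σ : Sph n => lin y σ ^ (m + 1) := (continuous_lin y).pow _
  simp only [sub_mul]
  rw [integral_sub (integrable_mul_continuous hwi hp) (integrable_mul_continuous hvi hp),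
    integral_sub (integrable_mul_continuous hwi hl) (integrable_mul_continuous hvi hl),
    hw y hy m, hv y hy m]
  ring

theorem MomentRel.expand {κ ev : ℝ} {w : Sph n → ℝ} (h : MomentRel κ ev w)
    (hwi : Integrable w (weighted n κ)) {y : Amb n} (hy : y (Fin.last n) = 0) (m : ℕ) :
    (m + 1) * ((n + alphaPlus κ + m) * ∫ σ, w σ * lin y σ ^ (m + 1) ∂(weighted n κ)
      - m * ‖y‖ ^ 2 * ∫ σ, w σ * lin y σ ^ (m - 1) ∂(weighted n κ))
      = ev * ∫ σ, w σ * lin y σ ^ (m + 1) ∂(weighted n κ) := by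
  rw [← h y hy m, ← integral_const_mul, ← integral_const_mul, ← integral_sub, ← integral_const_mul]
  · refine integral_congr_ae (.of_forall fun σ => ?_)
    simp only [powLap]
    ring
  · exact (integrable_mul_continuous hwi ((continuous_lin y).pow _)).const_mul _
  · exact (integrable_mul_continuous hwi ((continuous_lin y).pow _)).const_mul _

/-- Below or at the second eigenvalue, only the moments of degree at most one matter. -/
theorem MomentRel.ae_eq_zero {κ ev : ℝ} {w : Sph n → ℝ} (h : MomentRel κ ev w)
    (hwi : Integrable w (weighted n κ)) (hev : ev ≤ n + alphaPlus κ)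
    (h0 : ∫ σ, w σ ∂(weighted n κ) = 0)
    (h1 : ∀ y : Amb n, y (Fin.last n) = 0 → ∫ σ, w σ * lin y σ ∂(weighted n κ) = 0) :
    w =ᵐ[weighted n κ] 0 := by
  refine ae_eq_zero_of_moments (ae_weighted_mem_upper κ) hwi fun y hy d => ?_
  have hα := one_le_alphaPlus κ
  induction d using Nat.strong_induction_on with
  | _ d ih =>
    match d, ih with
    | 0, _ => simpa using h0
    | 1, _ => simpa using h1 y hy
    | m + 2, ih =>
      have e := h.expand hwi hy (m + 1)
      rw [Nat.add_sub_cancel, ih m (by omega), mul_zero, sub_zero, ← sub_eq_zero, ← mul_assoc,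
        ← sub_mul] at e
      -- The coefficient of the moment of degree `m + 2` is `(m+2)(n+α₊+m+1) - ev`, positive because
      -- `ev ≤ n + α₊`.
      refine (mul_eq_zero.mp e).resolve_left (ne_of_gt ?_)
      push_cast
      have hn : (0 : ℝ) ≤ n := Nat.cast_nonneg n
      have hm : (0 : ℝ) ≤ m := Nat.cast_nonneg m
      nlinarith [mul_nonneg hm hn, mul_nonneg hm hm]

theorem IsWeak.momentRel (hn : 1 ≤ n) {κ ev : ℝ} {w : Sph n → ℝ} {G : Sph n → Amb n}
    (h : IsWeak κ ev w G) : MomentRel κ ev w := fun _ hy m => h.integral_powLap hn hy m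

theorem IsWeak.integrable {κ ev : ℝ} {w : Sph n → ℝ} {G : Sph n → Amb n}
    (h : IsWeak κ ev w G) : Integrable w (weighted n κ) :=
  h.hasH10Grad.1.integrable (by norm_num)

theorem IsWeak.integral_eq_zero {κ ev : ℝ} {w : Sph n → ℝ} {G : Sph n → Amb n}
    (h : IsWeak κ ev w G) (hev : ev ≠ 0) : ∫ σ, w σ ∂(weighted n κ) = 0 :=
  (mul_eq_zero.mp h.ev_mul_integral).resolve_left hev

theorem IsWeak.integral_lin_eq_zero (hn : 1 ≤ n) {κ ev : ℝ} {w : Sph n → ℝ} {G : Sph n → Amb n}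
    (h : IsWeak κ ev w G) (hev : ev ≠ n + alphaPlus κ) {y : Amb n} (hy : y (Fin.last n) = 0) :
    ∫ σ, w σ * lin y σ ∂(weighted n κ) = 0 := by
  have e := (h.momentRel hn).expand h.integrable hy 0
  simp only [Nat.cast_zero, zero_add, zero_mul, sub_zero, one_mul, add_zero, pow_one] at e
  rw [← sub_eq_zero, ← sub_mul] at e
  exact (mul_eq_zero.mp e).resolve_left (sub_ne_zero.mpr hev.symm)

theorem IsWeak.ae_eq_zero (hn : 1 ≤ n) {κ ev : ℝ} {w : Sph n → ℝ} {G : Sph n → Amb n}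
    (h : IsWeak κ ev w G) (hev0 : ev ≠ 0) (hev : ev < n + alphaPlus κ) :
    w =ᵐ[weighted n κ] 0 :=
  (h.momentRel hn).ae_eq_zero h.integrable hev.le (h.integral_eq_zero hev0) fun _ hy =>
    h.integral_lin_eq_zero hn hev.ne hy

theorem exists_mem_upper : ∃ σ : Sph n, σ ∈ upper n :=
  ⟨⟨eN n, by simp⟩, by simp [upper, height]⟩

theorem dS_univ_ne_zero : dS n Set.univ ≠ 0 := by
  rw [dS, Measure.restrict_apply_univ]
  exact isOpen_upper.measure_ne_zero _ exists_mem_upper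

theorem weighted_univ_pos (n : ℕ) (κ : ℝ) : 0 < (weighted n κ).real Set.univ := by
  rw [Measure.real, ENNReal.toReal_pos_iff]
  refine ⟨pos_iff_ne_zero.mpr fun h => ?_, measure_lt_top _ _⟩
  exact dS_univ_ne_zero (dS_absolutelyContinuous_weighted κ h)

/-- Subtracting the mean kills the moment of degree 0; those of degree 1 vanish already, as `0 ≠ n +
α₊`. -/
theorem IsWeak.ae_eq_const (hn : 1 ≤ n) {κ : ℝ} {w : Sph n → ℝ} {G : Sph n → Amb n}
    (h : IsWeak κ 0 w G) : ∃ c : ℝ, w =ᵐ[weighted n κ] fun _ => c := by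
  have hν := weighted_univ_pos n κ
  have hα := one_le_alphaPlus κ
  have hpos : (0 : ℝ) < n + alphaPlus κ := by positivity
  set c := (∫ σ, w σ ∂(weighted n κ)) / (weighted n κ).real Set.univ with hc
  have hcw := isWeak_const (n := n) κ c
  have key := ((h.momentRel hn).sub (hcw.momentRel hn) h.integrable hcw.integrable).ae_eq_zero
    (h.integrable.sub hcw.integrable) hpos.le ?_ fun y hy => ?_
  · refine ⟨c, ?_⟩
    filter_upwards [key] with σ hσ
    exact sub_eq_zero.mp hσ
  · rw [integral_sub h.integrable hcw.integrable, integral_const, smul_eq_mul, hc]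
    field_simp
    ring
  · simp only [sub_mul]
    rw [integral_sub (integrable_mul_continuous h.integrable (continuous_lin y))
      (integrable_mul_continuous hcw.integrable (continuous_lin y)),
      h.integral_lin_eq_zero hn hpos.ne hy, hcw.integral_lin_eq_zero hn hpos.ne hy, sub_zero]

theorem IsWeak.ae_eq_lin (hn : 1 ≤ n) {κ : ℝ} {w : Sph n → ℝ} {G : Sph n → Amb n}
    (h : IsWeak κ (n + alphaPlus κ) w G) :
    ∃ z : Amb n, z (Fin.last n) = 0 ∧ w =ᵐ[weighted n κ] lin z := by
  have hν := weighted_univ_pos n κ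
  have hα := one_le_alphaPlus κ
  have hpos : (0 : ℝ) < n + alphaPlus κ := by positivity
  have hvi : Integrable (fun σ : Sph n => w σ • (σ : Amb n)) (weighted n κ) := by
    refine h.integrable.norm.mono' ?_ (.of_forall fun σ => ?_)
    · exact h.integrable.1.smul continuous_subtype_val.aestronglyMeasurable
    · rw [norm_smul, norm_sph, mul_one]
  set z₀ : Amb n := ∫ σ, w σ • (σ : Amb n) ∂(weighted n κ) with hz₀
  have hz₀y : ∀ y : Amb n, ⟪z₀, y⟫ = ∫ σ, w σ * lin y σ ∂(weighted n κ) := fun y => by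
    rw [real_inner_comm, hz₀, ← integral_inner hvi]
    simp only [inner_smul_right, lin]
  -- By `integral_lin_mul_lin` this factor gives `lin z` the same first moments against horizontal
  -- linear forms as `w`.
  set c : ℝ := (n + alphaPlus κ + 1) / (weighted n κ).real Set.univ with hc
  set z : Amb n := c • (z₀ - z₀ (Fin.last n) • eN n) with hz
  have hzN : z (Fin.last n) = 0 := by simp [hz]
  have hzw := isWeak_lin hn κ hzN
  have key := ((h.momentRel hn).sub (hzw.momentRel hn) h.integrable hzw.integrable).ae_eq_zero
    (h.integrable.sub hzw.integrable) le_rfl ?_ fun y hy => ?_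
  · refine ⟨z, hzN, ?_⟩
    filter_upwards [key] with σ hσ
    exact sub_eq_zero.mp hσ
  · rw [integral_sub h.integrable hzw.integrable, h.integral_eq_zero hpos.ne',
      hzw.integral_eq_zero hpos.ne', sub_zero]
  · simp only [sub_mul]
    rw [integral_sub (integrable_mul_continuous h.integrable (continuous_lin y))
      (integrable_mul_continuous hzw.integrable (continuous_lin y)), ← hz₀y]
    have e := integral_lin_mul_lin hn κ hy z
    have e2 : ⟪z, y⟫ = c * ⟪z₀, y⟫ := by
      rw [hz, inner_smul_left, inner_sub_left, inner_smul_left, inner_eN, hy]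
      simp
    rw [e2, hc] at e
    have hpos' : (0 : ℝ) < n + alphaPlus κ + 1 := by positivity
    have e3 : ∫ σ, lin z σ * lin y σ ∂(weighted n κ) = ⟪z₀, y⟫ := by
      field_simp at e
      linarith
    rw [e3, sub_self]

theorem eq_zero_of_lin_ae_eq_zero (hn : 1 ≤ n) (κ : ℝ) {z : Amb n} (hz : z (Fin.last n) = 0)
    (h : lin z =ᵐ[weighted n κ] 0) : z = 0 := by
  have e := integral_lin_mul_lin hn κ hz z
  have h0 : ∫ σ, lin z σ * lin z σ ∂(weighted n κ) = 0 := by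
    rw [← integral_zero (Sph n) ℝ (μ := weighted n κ)]
    refine integral_congr_ae ?_
    filter_upwards [h] with σ hσ
    rw [hσ]; simp
  rw [h0, mul_zero] at e
  have := (mul_eq_zero.mp e.symm).resolve_right (weighted_univ_pos n κ).ne'
  exact inner_self_eq_zero.mp this

/-! ### Eigenfunctions of the Hardy operator -/

theorem ae_eq_rho_mul {κ : ℝ} {ψ q : Sph n → ℝ}
    (h : (fun σ => ψ σ / rho κ σ) =ᵐ[weighted n κ] q) :
    ψ =ᵐ[dS n] fun σ => rho κ σ * q σ := by
  filter_upwards [(dS_absolutelyContinuous_weighted κ).ae_le h, ae_mem_upper] with σ h1 h2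
  rw [← h1, mul_div_cancel₀ _ (rho_pos κ h2).ne']

theorem div_rho_ae_eq (κ : ℝ) (q : Sph n → ℝ) :
    q =ᵐ[weighted n κ] fun σ => rho κ σ * q σ / rho κ σ := by
  filter_upwards [ae_weighted_mem_upper κ] with σ hσ
  rw [mul_div_cancel_left₀ _ (rho_pos κ hσ).ne']

theorem mu2_sub_mu1 (κ : ℝ) : mu2 (n + 1) κ - mu1 (n + 1) κ = n + alphaPlus κ := by
  unfold mu2; push_cast; ring

theorem isEigenfunction_rho (hn : 1 ≤ n) {κ : ℝ} (hκ : κ ≤ 1 / 4) :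
    IsEigenfunction (n := n) κ (mu1 (n + 1) κ) (rho κ) := by
  have h := (isWeak_const (n := n) κ 1).congr (div_rho_ae_eq κ _)
  simp only [mul_one] at h
  refine IsWeak.isEigenfunction hn hκ (G := 0) (by rwa [sub_self]) fun h0 => ?_
  have h1 : ∀ᵐ _ : Sph n ∂(dS n), False := by
    filter_upwards [h0, ae_mem_upper] with σ hσ hu
    exact (rho_pos κ hu).ne' hσ
  exact dS_univ_ne_zero (by simpa using h1)

theorem lin_single (j : Fin n) (σ : Sph n) :
    lin (EuclideanSpace.single j.castSucc 1) σ = (σ : Amb n) j.castSucc := by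
  simp [lin, EuclideanSpace.inner_single_left]

theorem ae_weighted_zero_of_rho_mul {κ : ℝ} {q : Sph n → ℝ}
    (h : (fun σ => rho κ σ * q σ) =ᵐ[dS n] 0) : q =ᵐ[weighted n κ] 0 := by
  filter_upwards [(weighted_absolutelyContinuous_dS κ).ae_le h, ae_weighted_mem_upper κ] with σ h1 h2
  exact (mul_eq_zero.mp h1).resolve_left (rho_pos κ h2).ne'

theorem isEigenfunction_rhoJ (hn : 1 ≤ n) {κ : ℝ} (hκ : κ ≤ 1 / 4) (j : Fin n) :
    IsEigenfunction (n := n) κ (mu2 (n + 1) κ) (rhoJ κ j) := by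
  have hz : (EuclideanSpace.single j.castSucc (1 : ℝ) : Amb n) (Fin.last n) = 0 := by
    simp [(Fin.castSucc_lt_last j).ne']
  have e : rhoJ κ j = fun σ => rho κ σ * lin (EuclideanSpace.single j.castSucc 1) σ := by
    ext σ; rw [lin_single]; rfl
  have h := (isWeak_lin hn κ hz).congr (div_rho_ae_eq κ _)
  rw [e]
  refine IsWeak.isEigenfunction hn hκ (by rwa [mu2_sub_mu1]) fun h0 => ?_
  have := eq_zero_of_lin_ae_eq_zero hn κ hz (ae_weighted_zero_of_rho_mul h0)
  simpa using congrArg (fun v : Amb n => v j.castSucc) this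

theorem lin_eq_sum {z : Amb n} (hz : z (Fin.last n) = 0) (σ : Sph n) :
    lin z σ = ∑ j : Fin n, z j.castSucc * (σ : Amb n) j.castSucc := by
  simp [lin, PiLp.inner_apply, Fin.sum_univ_castSucc, hz, mul_comm]

theorem eq_zero_of_sum_rhoJ (hn : 1 ≤ n) (κ : ℝ) (c : Fin n → ℝ)
    (h : (fun σ => ∑ j, c j * rhoJ κ j σ) =ᵐ[dS n] 0) : c = 0 := by
  let z : Amb n := WithLp.toLp 2 (Fin.snoc c 0)
  have hz : z (Fin.last n) = 0 := by simp [z]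
  have hzc : ∀ j : Fin n, z j.castSucc = c j := fun j => by simp [z]
  have e : (fun σ => ∑ j, c j * rhoJ κ j σ) = fun σ => rho κ σ * lin z σ := by
    ext σ
    rw [lin_eq_sum hz, Finset.mul_sum]
    refine Finset.sum_congr rfl fun j _ => ?_
    rw [hzc, rhoJ]; ring
  rw [e] at h
  have h0 := eq_zero_of_lin_ae_eq_zero hn κ hz (ae_weighted_zero_of_rho_mul h)
  ext j
  rw [← hzc j, h0]; rfl

theorem exists_eq_mul_rho (hn : 1 ≤ n) {κ : ℝ} (hκ : κ ≤ 1 / 4) {ψ : Sph n → ℝ}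
    (h : IsEigenfunction κ (mu1 (n + 1) κ) ψ) : ∃ c : ℝ, ψ =ᵐ[dS n] fun σ => c * rho κ σ := by
  obtain ⟨G, hG⟩ := h.exists_isWeak hn hκ
  rw [sub_self] at hG
  obtain ⟨c, hc⟩ := hG.ae_eq_const hn
  refine ⟨c, (ae_eq_rho_mul hc).trans (.of_forall fun σ => mul_comm _ _)⟩

theorem exists_eq_sum_rhoJ (hn : 1 ≤ n) {κ : ℝ} (hκ : κ ≤ 1 / 4) {ψ : Sph n → ℝ}
    (h : IsEigenfunction κ (mu2 (n + 1) κ) ψ) :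
    ∃ c : Fin n → ℝ, ψ =ᵐ[dS n] fun σ => ∑ j, c j * rhoJ κ j σ := by
  obtain ⟨G, hG⟩ := h.exists_isWeak hn hκ
  rw [mu2_sub_mu1] at hG
  obtain ⟨z, hz, hzw⟩ := hG.ae_eq_lin hn
  refine ⟨fun j => z j.castSucc, (ae_eq_rho_mul hzw).trans (.of_forall fun σ => ?_)⟩
  simp only [lin_eq_sum hz, Finset.mul_sum, rhoJ]
  refine Finset.sum_congr rfl fun j _ => ?_
  ring

/-- There is no eigenvalue below `mu2` other than `mu1`. -/
theorem eq_mu1_or_mu2_le (hn : 1 ≤ n) {κ ev : ℝ} (hκ : κ ≤ 1 / 4) (h : ev ∈ eigenvalues n κ) :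
    ev = mu1 (n + 1) κ ∨ mu2 (n + 1) κ ≤ ev := by
  obtain ⟨ψ, hψ⟩ := h
  obtain ⟨G, hG⟩ := hψ.exists_isWeak hn hκ
  by_contra! hne
  have h1 := mu2_sub_mu1 (n := n) κ
  have h0 := hG.ae_eq_zero hn (sub_ne_zero.mpr hne.1) (by linarith [hne.2])
  refine hψ.2.1 ((ae_eq_rho_mul h0).trans (.of_forall fun σ => ?_))
  simp

theorem mu1_lt_mu2 (n : ℕ) (κ : ℝ) : mu1 (n + 1) κ < mu2 (n + 1) κ := by
  have h1 := mu2_sub_mu1 (n := n) κ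
  have h2 := one_le_alphaPlus κ
  have h3 : (0 : ℝ) ≤ n := Nat.cast_nonneg n
  linarith

/-! ### The Hardy inequality and the Rayleigh quotient -/

theorem integral_rho_mul_energy (hn : 1 ≤ n) {κ : ℝ} (hκ : κ ≤ 1 / 4) {φ : Sph n → ℝ}
    (hφ : IsTest φ) :
    ∫ σ, (‖sphGrad (fun σ => rho κ σ * φ σ) σ‖ ^ 2
        - κ * (height σ ^ 2)⁻¹ * (rho κ σ * φ σ) ^ 2) ∂(dS n)
      = (∫ σ, ‖sphGrad φ σ‖ ^ 2 ∂(weighted n κ))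
        + mu1 (n + 1) κ * ∫ σ, φ σ ^ 2 ∂(weighted n κ) := by
  have h := integral_ground_state hn hκ hφ hφ
  rw [integral_add (hφ.inner_sphGrad hφ.smooth).integrable
    ((hφ.smooth_mul hφ.smooth).const_mul _).integrable, integral_const_mul] at h
  simpa only [real_inner_self_eq_norm_sq, ← sq] using h

theorem integral_rho_mul_sq (κ : ℝ) (φ : Sph n → ℝ) :
    ∫ σ, (rho κ σ * φ σ) ^ 2 ∂(dS n) = ∫ σ, φ σ ^ 2 ∂(weighted n κ) := by
  rw [integral_weighted]
  simp only [mul_pow]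

/-- The ground state representation of `ζ = ρ φ`, without its nonnegative gradient term. -/
theorem IsTest.hardy_inequality (hn : 1 ≤ n) {κ : ℝ} (hκ : κ ≤ 1 / 4) {ζ : Sph n → ℝ}
    (hζ : IsTest ζ) :
    κ * ∫ σ, (height σ ^ 2)⁻¹ * ζ σ ^ 2 ∂(dS n)
      ≤ (∫ σ, ‖sphGrad ζ σ‖ ^ 2 ∂(dS n)) - mu1 (n + 1) κ * ∫ σ, ζ σ ^ 2 ∂(dS n) := by
  have hφ : IsTest (fun σ => height σ ^ (-(alphaPlus κ / 2)) * ζ σ) := hζ.rpow_mul _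
  have e : (fun σ => rho κ σ * (height σ ^ (-(alphaPlus κ / 2)) * ζ σ)) = ζ := by
    ext σ
    by_cases hσ : σ ∈ upper n
    · have := rho_pos κ hσ
      have e : height σ ^ (-(alphaPlus κ / 2)) = (rho κ σ)⁻¹ := Real.rpow_neg (le_of_lt hσ) _
      rw [e]; field_simp
    · simp [hζ.zero_of_notMem hσ]
  have h1 := integral_rho_mul_energy hn hκ hφ
  have h2 := integral_rho_mul_sq κ fun σ => height σ ^ (-(alphaPlus κ / 2)) * ζ σ
  rw [← h2, e] at h1
  simp only [congrFun e] at h1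
  have hi : Integrable (fun σ => κ * (height σ ^ 2)⁻¹ * ζ σ ^ 2) (dS n) := by
    simpa only [← sq] using (hζ.hardy hζ κ).integrable
  have hg : Integrable (fun σ => ‖sphGrad ζ σ‖ ^ 2) (dS n) :=
    integrable_of_continuous (hζ.smooth.continuous_sphGrad.norm.pow 2)
  rw [integral_sub hg hi] at h1
  simp only [mul_assoc] at h1
  rw [integral_const_mul] at h1
  have h3 : 0 ≤ ∫ σ, ‖sphGrad (fun σ => height σ ^ (-(alphaPlus κ / 2)) * ζ σ) σ‖ ^ 2
      ∂(weighted n κ) := integral_nonneg fun σ => sq_nonneg _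
  linarith

theorem HasH10Grad.hardy_inequality (hn : 1 ≤ n) {κ : ℝ} (hκ0 : 0 < κ) (hκ : κ ≤ 1 / 4)
    {ψ : Sph n → ℝ} {G : Sph n → Amb n} (h : HasH10Grad (dS n) ψ G) :
    Integrable (fun σ => (height σ ^ 2)⁻¹ * ψ σ ^ 2) (dS n) ∧
    κ * ∫ σ, (height σ ^ 2)⁻¹ * ψ σ ^ 2 ∂(dS n)
      ≤ (∫ σ, ‖G σ‖ ^ 2 ∂(dS n)) - mu1 (n + 1) κ * ∫ σ, ψ σ ^ 2 ∂(dS n) := by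
  obtain ⟨hψ, hG, φ, hφ, h1, h2⟩ := h
  let D : ℕ → ℝ := fun k => κ⁻¹ * ((∫ σ, ‖sphGrad (φ k) σ‖ ^ 2 ∂(dS n))
    - mu1 (n + 1) κ * ∫ σ, φ k σ ^ 2 ∂(dS n))
  let D₀ : ℝ := κ⁻¹ * ((∫ σ, ‖G σ‖ ^ 2 ∂(dS n)) - mu1 (n + 1) κ * ∫ σ, ψ σ ^ 2 ∂(dS n))
  have hD : Tendsto D atTop (𝓝 D₀) := by
    have l1 := tendsto_integral_norm_sq (fun k => (hφ k).memLp_sphGrad) hG h2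
    have l2 := tendsto_integral_norm_sq (fun k => (hφ k).memLp) hψ h1
    simp only [Real.norm_eq_abs, sq_abs] at l2
    exact (l1.sub (l2.const_mul _)).const_mul _
  have hle : ∀ k, ∫ σ, (height σ ^ 2)⁻¹ * φ k σ ^ 2 ∂(dS n) ≤ D k := fun k => by
    rw [show D k = _ / κ from inv_mul_eq_div _ _, le_div_iff₀ hκ0, mul_comm]
    exact (hφ k).hardy_inequality hn hκ
  have hnn : ∀ (f : Sph n → ℝ) (σ : Sph n), 0 ≤ (height σ ^ 2)⁻¹ * f σ ^ 2 := fun f σ => by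
    positivity
  have hD0 : 0 ≤ D₀ := ge_of_tendsto' hD fun k => (integral_nonneg (hnn (φ k))).trans (hle k)
  -- The inequality passes to the closure by Fatou's lemma along an almost everywhere convergent
  -- subsequence; this gives integrability and the bound together.
  obtain ⟨ns, hns, hae⟩ := (tendstoInMeasure_of_tendsto_eLpNorm (by norm_num)
    (fun k => (hφ k).memLp.1) hψ.1 h1).exists_seq_tendsto_ae
  have hhm : Measurable fun σ : Sph n => (height σ ^ 2)⁻¹ :=
    (continuous_height.measurable.pow_const 2).inv
  have hm : AEStronglyMeasurable (fun σ => (height σ ^ 2)⁻¹ * ψ σ ^ 2) (dS n) :=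
    hhm.aestronglyMeasurable.mul (hψ.1.pow 2)
  have hlin : ∫⁻ σ, ENNReal.ofReal ((height σ ^ 2)⁻¹ * ψ σ ^ 2) ∂(dS n) ≤ ENNReal.ofReal D₀ := by
    calc ∫⁻ σ, ENNReal.ofReal ((height σ ^ 2)⁻¹ * ψ σ ^ 2) ∂(dS n)
        = ∫⁻ σ, liminf (fun k => ENNReal.ofReal ((height σ ^ 2)⁻¹ * φ (ns k) σ ^ 2)) atTop
            ∂(dS n) := by
          refine lintegral_congr_ae ?_
          filter_upwards [hae] with σ hσ
          exact (ENNReal.tendsto_ofReal ((hσ.pow 2).const_mul _)).liminf_eq.symm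
      _ ≤ liminf (fun k => ∫⁻ σ, ENNReal.ofReal ((height σ ^ 2)⁻¹ * φ (ns k) σ ^ 2) ∂(dS n))
            atTop := lintegral_liminf_le fun k =>
          (hhm.mul ((hφ (ns k)).continuous.measurable.pow_const 2)).ennreal_ofReal
      _ ≤ liminf (fun k => ENNReal.ofReal (D (ns k))) atTop := by
          refine liminf_le_liminf (.of_forall fun k => ?_)
          have hi : Integrable (fun σ => (height σ ^ 2)⁻¹ * φ (ns k) σ ^ 2) (dS n) := by
            simpa only [← sq, one_mul] using ((hφ (ns k)).hardy (hφ (ns k)) 1).integrable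
          rw [← ofReal_integral_eq_lintegral_ofReal hi (.of_forall (hnn _))]
          exact ENNReal.ofReal_le_ofReal (hle _)
      _ = ENNReal.ofReal D₀ :=
          (ENNReal.tendsto_ofReal (hD.comp hns.tendsto_atTop)).liminf_eq
  refine ⟨⟨hm, ?_⟩, ?_⟩
  · rw [hasFiniteIntegral_iff_ofReal (.of_forall (hnn ψ))]
    exact hlin.trans_lt ENNReal.ofReal_lt_top
  · rw [mul_comm, ← le_div_iff₀ hκ0, ← inv_mul_eq_div,
      integral_eq_lintegral_of_nonneg_ae (.of_forall (hnn ψ)) hm]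
    exact ENNReal.toReal_le_of_le_ofReal hD0 hlin

theorem mu1_mem_lowerBounds (hn : 1 ≤ n) {κ : ℝ} (hκ0 : 0 < κ) (hκ : κ ≤ 1 / 4) :
    mu1 (n + 1) κ ∈ lowerBounds (rayleighQuotients n κ) := by
  rintro r ⟨ψ, G, h, h0, rfl⟩
  obtain ⟨hi, hle⟩ := h.hardy_inequality hn hκ0 hκ
  have hψ2 : Integrable (fun σ => ψ σ ^ 2) (dS n) := h.1.integrable_sq
  have hG2 : Integrable (fun σ => ‖G σ‖ ^ 2) (dS n) := h.2.1.integrable_norm_pow (by norm_num)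
  have hpos : 0 < ∫ σ, ψ σ ^ 2 ∂(dS n) := by
    refine lt_of_le_of_ne (integral_nonneg fun σ => sq_nonneg _) fun he => h0 ?_
    have := (integral_eq_zero_iff_of_nonneg (fun σ => sq_nonneg _) hψ2).mp he.symm
    filter_upwards [this] with σ hσ
    simpa using hσ
  rw [le_div_iff₀ hpos]
  simp only [mul_assoc]
  rw [integral_sub hG2 (hi.const_mul κ), integral_const_mul]
  linarith

theorem isGLB_rayleighQuotients (hn : 1 ≤ n) {κ : ℝ} (hκ0 : 0 < κ) (hκ : κ ≤ 1 / 4) :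
    IsGLB (rayleighQuotients n κ) (mu1 (n + 1) κ) := by
  refine ⟨mu1_mem_lowerBounds hn hκ0 hκ, fun b hb => ?_⟩
  have hν := weighted_univ_pos n κ
  have ht := isTest_cutoff n
  have l1 : Tendsto (fun k => ∫ σ, cutoff n k σ ^ 2 ∂(weighted n κ)) atTop
      (𝓝 ((weighted n κ).real Set.univ)) := by
    have h := (Smooth.hasH10Grad κ (smoothAt_const (n := n) 1)).2.1
    simp only [one_mul] at h
    have := tendsto_integral_norm_sq (fun k => (ht k).memLp) (memLp_const 1) h
    simpa using this
  -- The trial functions are `ρ` times the cut-offs: `ρ` itself need not lie in the unweighted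
  -- `H^1_0`, since for `κ = 1/4` its gradient is not square integrable.
  have l2 := (tendsto_integral_sphGrad_cutoff n κ).add (l1.const_mul (mu1 (n + 1) κ))
  rw [zero_add] at l2
  have hle : b * (weighted n κ).real Set.univ ≤ mu1 (n + 1) κ * (weighted n κ).real Set.univ := by
    refine le_of_tendsto_of_tendsto (l1.const_mul b) l2 ?_
    filter_upwards [l1.eventually (lt_mem_nhds hν)] with k hk
    have hT := (ht k).rho_mul κ
    have hmem := hb ⟨fun σ => rho κ σ * cutoff n k σ, sphGrad fun σ => rho κ σ * cutoff n k σ,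
      ⟨hT.memLp, hT.memLp_sphGrad, fun _ => _, fun _ => hT, by simp, by simp⟩, fun h0 => ?_, rfl⟩
    · rw [integral_rho_mul_energy hn hκ (ht k), integral_rho_mul_sq, le_div_iff₀ hk] at hmem
      exact hmem
    · refine hk.ne' ?_
      rw [← integral_zero (Sph n) ℝ (μ := weighted n κ)]
      refine integral_congr_ae ?_
      filter_upwards [ae_weighted_zero_of_rho_mul h0] with σ hσ
      rw [hσ]; simp
  exact le_of_mul_le_mul_right hle hν

end HardySphere

end

/-! ### The main theorem -/

open HardySphere in
theorem mainTheorem7 (n : ℕ) (hn : 1 ≤ n) (κ : ℝ) (hκ0 : 0 < κ) (hκ1 : κ ≤ 1 / 4) :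
    -- the Hardy term is finite on `H^1_0`, so that the Rayleigh quotients make sense
    (∀ (ψ : Sph n → ℝ), MemH10 (dS n) ψ →
      Integrable (fun σ => (height σ ^ 2)⁻¹ * ψ σ ^ 2) (dS n)) ∧
    -- the first eigenvalue, as the infimum of the Rayleigh quotient and as least eigenvalue
    IsGLB (rayleighQuotients n κ) (mu1 (n + 1) κ) ∧
    IsLeast (eigenvalues n κ) (mu1 (n + 1) κ) ∧
    -- its positive eigenfunction, which is unique up to a factor
    (∀ σ ∈ upper n, 0 < rho κ σ) ∧
    IsEigenfunction (n := n) κ (mu1 (n + 1) κ) (rho κ) ∧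
    (∀ ψ : Sph n → ℝ, IsEigenfunction κ (mu1 (n + 1) κ) ψ →
      ∃ c : ℝ, ψ =ᵐ[dS n] fun σ => c * rho κ σ) ∧
    -- the second eigenvalue
    IsLeast {ev | ev ∈ eigenvalues n κ ∧ mu1 (n + 1) κ < ev} (mu2 (n + 1) κ) ∧
    -- its `N - 1` independent eigenfunctions, which span the eigenspace
    (∀ j : Fin n, IsEigenfunction κ (mu2 (n + 1) κ) (rhoJ κ j)) ∧
    (∀ c : Fin n → ℝ, (fun σ => ∑ j, c j * rhoJ κ j σ) =ᵐ[dS n] 0 → c = 0) ∧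
    (∀ ψ : Sph n → ℝ, IsEigenfunction κ (mu2 (n + 1) κ) ψ →
      ∃ c : Fin n → ℝ, ψ =ᵐ[dS n] fun σ => ∑ j, c j * rhoJ κ j σ) := by
  refine ⟨fun ψ ⟨G, hG⟩ => (hG.hardy_inequality hn hκ0 hκ1).1,
    isGLB_rayleighQuotients hn hκ0 hκ1,
    ⟨⟨_, isEigenfunction_rho hn hκ1⟩, fun ev hev => ?_⟩, fun σ hσ => rho_pos κ hσ,
    isEigenfunction_rho hn hκ1, fun ψ hψ => exists_eq_mul_rho hn hκ1 hψ,
    -- The index `0 : Fin n` exists because `n ≥ 1`, so `μ₂` is attained.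
    ⟨⟨⟨_, isEigenfunction_rhoJ hn hκ1 ⟨0, hn⟩⟩, mu1_lt_mu2 n κ⟩, fun ev hev => ?_⟩,
    isEigenfunction_rhoJ hn hκ1, eq_zero_of_sum_rhoJ hn κ,
    fun ψ hψ => exists_eq_sum_rhoJ hn hκ1 hψ⟩
  · rcases eq_mu1_or_mu2_le hn hκ1 hev with h | h
    · exact h.ge
    · exact (mu1_lt_mu2 n κ).le.trans h
  · exact (eq_mu1_or_mu2_le hn hκ1 hev.1).resolve_left hev.2.ne'
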